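/- Let $d=1$ and $E_r=S_r(\mathbb R)$ (real symmetric $r\times r$ matrices), or $d=2$ and $E_r=H_r(\mathbb C)$ (complex Hermitian $r\times r$ matrices), with the inner product $\langle x\mid y\rangle=\mathrm{tr}(xy)$ and the corresponding Lebesgue measure, and let $E_r^+\subset E_r$ be the cone of positive definite matrices; $|\cdot|$ denotes the determinant. Put $\frac nr=\frac{r-1}2d+1$. For $\mu>\frac{r-1}2d$ and $\xi\in E_r^+$ the Wishart distribution $W_r(\mu,\xi)$ has the density $$p^\mu(x\mid\xi)=\frac{|x|^{\mu-\frac nr}}{\Gamma_r(\mu)}\,|\xi|^{\mu}\,e^{-\langle\xi\mid x\rangle}\quad(x\in E_r^+),\qquad \Gamma_r(\mu)=\int_{E_r^+}|x|^{\mu-\frac nr}e^{-\mathrm{tr}(x)}\,dx .$$ Let $H$ be the Fisher information of the family $\{W_r(\mu,\xi)\}_{\xi\in E_r^+}$ per unit of $\mu$, i.e. $$H_\xi(u,v)=\frac1\mu\int_{E_r^+}\partial_u\log p^\mu(x\mid\xi)\;\partial_v\log p^\mu(x\mid\xi)\;p^\mu(x\mid\xi)\,dx\qquad(u,v\in E_r).$$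 In linear coordinates on $E_r$, with $G(\xi)$ the matrix of $H_\xi$, the Laplace--Beltrami operator is $$\Delta_{\mathrm{LB}}f=|G|^{-\frac12}\sum_{i,j}\partial_i\bigl(|G|^{\frac12}(G^{-1})_{ij}\,\partial_jf\bigr).$$ Let $r=k^{(1)}+\dots+k^{(h)}$ be a partition into positive integers and $r_{(i)}=k^{(1)}+\dots+k^{(i)}$. For $\xi\in E_r^+$ let $\zeta_{(i)}\in E_{r_{(i)}}^+$ be the Schur complement in $\xi$ of its lower right $(r-r_{(i)})\times(r-r_{(i)})$ block, and let $\xi_0^{(i)}$ be the lower right $k^{(i)}\times k^{(i)}$ block of $\zeta_{(i)}$. For $\mathbf t\in\mathbb R^h$ let $\pi_{\mathbf t}(\xi)=\prod_{i=1}^h|\xi_0^{(i)}|^{t^{(i)}}$, and let $\pi_J(\xi)$ be the Jeffreys prior density, i.e. the square root of the determinant of the matrix of $H_\xi$ in an orthonormal basis of $E_r$. Put $$t_R^{(i)}=-\Bigl(\frac{2r_{(i)}-k^{(i)}-1}2\,d+1\Bigr).$$ Then $H$ is positive definite at every point of $E_r^+$, and for every $\mathbf t\in\mathbb R^h$ the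 function $K_{\mathbf t}=(\pi_{\mathbf t}/\pi_J)^{1/2}$ is smooth and positive on $E_r^+$, satisfies there $$K_{\mathbf t}(\xi)=\prod_{i=1}^h\bigl|\xi_0^{(i)}\bigr|^{\frac12\left(t^{(i)}+\frac{r-1}2d+1\right)},$$ and is an eigenfunction of the Laplace--Beltrami operator: in any linear coordinates on $E_r$, $\Delta_{\mathrm{LB}}K_{\mathbf t}=\lambda(\mathbf t)\,K_{\mathbf t}$ on $E_r^+$ with $$\lambda(\mathbf t)=\sum_{i=1}^h\left(\frac14k^{(i)}\bigl(t^{(i)}-t_R^{(i)}\bigr)^2-\frac{d^2}{16}k^{(i)}\bigl(r-2r_{(i)}+k^{(i)}\bigr)^2\right).$$ Moreover $\lambda(\mathbf t_R)\le\lambda(\mathbf t)$ for all $\mathbf t\in\mathbb R^h$. -/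

import Mathlib

open scoped ContDiff ComplexOrder

noncomputable section

namespace Wishart

/-! ### The Euclidean space of real symmetric (`𝕜 = ℝ`) or complex Hermitian (`𝕜 = ℂ`) matrices -/

/-- The real vector space of self-adjoint matrices with entries in `𝕜`:
symmetric matrices for `𝕜 = ℝ`, Hermitian matrices for `𝕜 = ℂ`. -/
def Herm (𝕜 ι : Type*) [RCLike 𝕜] [Fintype ι] [DecidableEq ι] : Type _ :=
  selfAdjoint.submodule ℝ (Matrix ι ι 𝕜)

section Euclidean

variable {𝕜 ι : Type*} [RCLike 𝕜] [Fintype ι] [DecidableEq ι]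

instance : AddCommGroup (Herm 𝕜 ι) :=
  inferInstanceAs (AddCommGroup (selfAdjoint.submodule ℝ (Matrix ι ι 𝕜)))

instance : Module ℝ (Herm 𝕜 ι) :=
  inferInstanceAs (Module ℝ (selfAdjoint.submodule ℝ (Matrix ι ι 𝕜)))

instance : FiniteDimensional ℝ (Herm 𝕜 ι) :=
  inferInstanceAs (FiniteDimensional ℝ (selfAdjoint.submodule ℝ (Matrix ι ι 𝕜)))

/-- The matrix underlying a self-adjoint matrix. -/
def Herm.mat (x : Herm 𝕜 ι) : Matrix ι ι 𝕜 := x.1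

lemma Herm.mat_conjTranspose (x : Herm 𝕜 ι) : x.mat.conjTranspose = x.mat := x.2

lemma Herm.mat_injective : Function.Injective (Herm.mat : Herm 𝕜 ι → Matrix ι ι 𝕜) :=
  Subtype.val_injective

@[simp] lemma Herm.mat_zero : (0 : Herm 𝕜 ι).mat = 0 := rfl

@[simp] lemma Herm.mat_add (x y : Herm 𝕜 ι) : (x + y).mat = x.mat + y.mat := rfl

@[simp] lemma Herm.mat_smul (c : ℝ) (x : Herm 𝕜 ι) : (c • x).mat = c • x.mat := rfl

/-- The inner product `⟨x | y⟩ = tr (x y)` (a real number for self-adjoint `x`, `y`). -/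
instance innerCore : InnerProductSpace.Core ℝ (Herm 𝕜 ι) where
  inner x y := RCLike.re (x.mat * y.mat).trace
  conj_inner_symm x y := by simp [Matrix.trace_mul_comm x.mat y.mat]
  re_inner_nonneg x := by
    have h : (x.mat * x.mat).trace = ∑ i, ∑ j, star (x.mat j i) * x.mat j i := by
      simp only [Matrix.trace, Matrix.diag_apply, Matrix.mul_apply]
      refine Finset.sum_congr rfl fun i _ => Finset.sum_congr rfl fun j _ => ?_
      rw [← Matrix.conjTranspose_apply, x.mat_conjTranspose]
    rw [h]
    simp only [map_sum, RCLike.star_def, RCLike.conj_mul, RCLike.re_to_real]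
    exact Finset.sum_nonneg fun i _ => Finset.sum_nonneg fun j _ => by
      rw [← RCLike.ofReal_pow, RCLike.ofReal_re]; positivity
  add_left x y z := by simp [add_mul]
  smul_left x y c := by simp [RCLike.smul_re]
  definite x hx := by
    have h : (x.mat * x.mat).trace = ∑ i, ∑ j, star (x.mat j i) * x.mat j i := by
      simp only [Matrix.trace, Matrix.diag_apply, Matrix.mul_apply]
      refine Finset.sum_congr rfl fun i _ => Finset.sum_congr rfl fun j _ => ?_
      rw [← Matrix.conjTranspose_apply, x.mat_conjTranspose]
    rw [h] at hx
    simp only [map_sum, RCLike.star_def, RCLike.conj_mul] at hx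
    have h0 : ∀ i j, (0 : ℝ) ≤ RCLike.re ((‖x.mat j i‖ : 𝕜) ^ 2) := fun i j => by
      rw [← RCLike.ofReal_pow, RCLike.ofReal_re]; positivity
    apply Herm.mat_injective
    ext j i
    have h1 := (Finset.sum_eq_zero_iff_of_nonneg
      (fun i _ => Finset.sum_nonneg fun j _ => h0 i j)).1 hx i (Finset.mem_univ i)
    have h2 := (Finset.sum_eq_zero_iff_of_nonneg (fun j _ => h0 i j)).1 h1 j (Finset.mem_univ j)
    rw [← RCLike.ofReal_pow, RCLike.ofReal_re] at h2
    simpa using h2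

instance : NormedAddCommGroup (Herm 𝕜 ι) := innerCore.toNormedAddCommGroup

instance : InnerProductSpace ℝ (Herm 𝕜 ι) := InnerProductSpace.ofCore innerCore.toCore

instance : MeasurableSpace (Herm 𝕜 ι) := borel _

instance : BorelSpace (Herm 𝕜 ι) := ⟨rfl⟩

lemma Herm.inner_eq (x y : Herm 𝕜 ι) : inner ℝ x y = RCLike.re (x.mat * y.mat).trace := rfl

end Euclidean

/-! ### Wishart distributions and their Fisher metric -/

/-- The determinant of a self-adjoint matrix, as a real number. -/
def rdet {𝕜 ι : Type*} [RCLike 𝕜] [Fintype ι] [DecidableEq ι] (A : Matrix ι ι 𝕜) : ℝ :=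
  RCLike.re A.det

/-- The symmetric cone of positive definite self-adjoint matrices. -/
def cone (𝕜 ι : Type*) [RCLike 𝕜] [Fintype ι] [DecidableEq ι] : Set (Herm 𝕜 ι) :=
  {x | x.mat.PosDef}

/-- The Peirce invariant `d`: `1` for `ℝ` and `2` for `ℂ`. -/
def peirceInv (𝕜 : Type*) [RCLike 𝕜] : ℝ := Module.finrank ℝ 𝕜

/-- The ratio `n / r = (r - 1) d / 2 + 1` of the dimension `n = r + r (r - 1) d / 2` of the space
of self-adjoint matrices to their size `r`. -/
def dimRatio (𝕜 ι : Type*) [RCLike 𝕜] [Fintype ι] : ℝ :=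
  ((Fintype.card ι : ℝ) - 1) / 2 * peirceInv 𝕜 + 1

section Family

variable {𝕜 ι : Type*} [RCLike 𝕜] [Fintype ι] [DecidableEq ι]

/-- The multivariate gamma function `Γ_r(μ)`. -/
def multiGamma (𝕜 ι : Type*) [RCLike 𝕜] [Fintype ι] [DecidableEq ι] (μ : ℝ) : ℝ :=
  ∫ x in cone 𝕜 ι, rdet x.mat ^ (μ - dimRatio 𝕜 ι) * Real.exp (-RCLike.re x.mat.trace)

/-- The density at `x` of the Wishart distribution `W_r(μ, ξ)`, with respect to Lebesgue measure
on the cone. -/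
def density (μ : ℝ) (ξ x : Herm 𝕜 ι) : ℝ :=
  rdet x.mat ^ (μ - dimRatio 𝕜 ι) / multiGamma 𝕜 ι μ * rdet ξ.mat ^ μ * Real.exp (-inner ℝ ξ x)

/-- The Fisher information of the family `ξ ↦ W_r(μ, ξ)` at `ξ` in the directions `u`, `v`:
the expected product of the directional derivatives of the log-likelihood. -/
def fisher (μ : ℝ) (ξ u v : Herm 𝕜 ι) : ℝ :=
  ∫ x in cone 𝕜 ι, fderiv ℝ (fun η => Real.log (density μ η x)) ξ u *
    fderiv ℝ (fun η => Real.log (density μ η x)) ξ v * density μ ξ x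

/-- The Fisher metric per unit of observation, `μ⁻¹` times the Fisher information of `W_r(μ, ·)`.
For `μ = 1` it is the Fisher information itself. -/
def unitFisher (μ : ℝ) (ξ u v : Herm 𝕜 ι) : ℝ := μ⁻¹ * fisher μ ξ u v

end Family

/-! ### The Laplace–Beltrami operator in linear coordinates -/

section LaplaceBeltrami

variable {E β : Type*} [NormedAddCommGroup E] [NormedSpace ℝ E] [Fintype β]

/-- The matrix of the metric `g` at `x` in the linear coordinates given by the basis `b`. -/
def gram (g : E → E → E → ℝ) (b : Module.Basis β ℝ E) (x : E) : Matrix β β ℝ :=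
  Matrix.of fun i j => g x (b i) (b j)

/-- The Laplace–Beltrami operator
`Δ f = |G|^(-1/2) ∑ᵢ ∂ᵢ ( |G|^(1/2) ∑ⱼ (G⁻¹)ᵢⱼ ∂ⱼ f )`
of the metric `g`, in the linear coordinates given by the basis `b`. -/
def laplaceBeltrami [DecidableEq β] (g : E → E → E → ℝ) (b : Module.Basis β ℝ E)
    (f : E → ℝ) (x : E) : ℝ :=
  (√(gram g b x).det)⁻¹ *
    ∑ i, fderiv ℝ (fun y => √(gram g b y).det *
      ∑ j, (gram g b y)⁻¹ i j * fderiv ℝ f y (b j)) x (b i)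

end LaplaceBeltrami

/-- The density (with respect to Lebesgue measure `dξ`) of the Jeffreys prior: the square root of
the determinant of the Fisher metric, computed in an orthonormal basis for `tr (x y)`. -/
def jeffreys {𝕜 ι : Type*} [RCLike 𝕜] [Fintype ι] [DecidableEq ι] (μ : ℝ) (ξ : Herm 𝕜 ι) : ℝ :=
  √(gram (unitFisher μ) (stdOrthonormalBasis ℝ (Herm 𝕜 ι)).toBasis ξ).det

/-! ### Block partition and the family of priors -/

/-- The row and column indices of `r × r` matrices, `r = k⁽¹⁾ + ⋯ + k⁽ʰ⁾`, grouped into blocks: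
the index `⟨i, a⟩` is the `a`-th one of the `i`-th block. -/
abbrev Idx {h : ℕ} (k : Fin h → ℕ) : Type := (i : Fin h) × Fin (k i)

section Blocks

variable {𝕜 : Type*} [RCLike 𝕜] {h : ℕ} {k : Fin h → ℕ}

/-- `ζ_(i)`: the Schur complement in `ξ` of the lower right part of size `r - r_(i)`. -/
def zeta (ξ : Matrix (Idx k) (Idx k) 𝕜) (i : Fin h) :
    Matrix {p : Idx k // p.1 ≤ i} {p : Idx k // p.1 ≤ i} 𝕜 :=
  ξ.toBlock (fun p => p.1 ≤ i) (fun p => p.1 ≤ i) -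
    ξ.toBlock (fun p => p.1 ≤ i) (fun p => i < p.1) *
      (ξ.toBlock (fun p => i < p.1) (fun p => i < p.1))⁻¹ *
      ξ.toBlock (fun p => i < p.1) (fun p => p.1 ≤ i)

/-- `ξ₀⁽ⁱ⁾`: the lower right `k⁽ⁱ⁾ × k⁽ⁱ⁾` block of `ζ_(i)`; for the first block it is all of
`ζ_(i)`. -/
def xiZero (ξ : Matrix (Idx k) (Idx k) 𝕜) (i : Fin h) : Matrix (Fin (k i)) (Fin (k i)) 𝕜 :=
  (zeta ξ i).submatrix (fun a => ⟨⟨i, a⟩, le_rfl⟩) (fun a => ⟨⟨i, a⟩, le_rfl⟩)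

/-- The density `∏ᵢ |ξ₀⁽ⁱ⁾| ^ t⁽ⁱ⁾` of the prior `π_t`. The change of parameters `ξ ↦ φ` has
Jacobian `1`, so this is the density both with respect to `dξ` and with respect to `dφ`. -/
def prior (t : Fin h → ℝ) (ξ : Herm 𝕜 (Idx k)) : ℝ :=
  ∏ i, rdet (xiZero ξ.mat i) ^ t i

/-- `K_t = (π_t / π_J) ^ (1/2)`. -/
def K (μ : ℝ) (t : Fin h → ℝ) (ξ : Herm 𝕜 (Idx k)) : ℝ :=
  (prior t ξ / jeffreys μ ξ) ^ (1 / 2 : ℝ)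

end Blocks

section Exponents

variable {h : ℕ}

/-- `r = k⁽¹⁾ + ⋯ + k⁽ʰ⁾`. -/
def rank (k : Fin h → ℕ) : ℝ := ∑ j, (k j : ℝ)

/-- `r_(i) = k⁽¹⁾ + ⋯ + k⁽ⁱ⁾`. -/
def partialRank (k : Fin h → ℕ) (i : Fin h) : ℝ := ∑ j ∈ Finset.Iic i, (k j : ℝ)

/-- `t_R⁽ⁱ⁾ = -((2 r_(i) - k⁽ⁱ⁾ - 1) d / 2 + 1)`. -/
def tR (d : ℝ) (k : Fin h → ℕ) (i : Fin h) : ℝ :=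
  -((2 * partialRank k i - k i - 1) / 2 * d + 1)

/-- The eigenvalue belonging to `K_t`. -/
def eigenvalue (d : ℝ) (k : Fin h → ℕ) (t : Fin h → ℝ) : ℝ :=
  ∑ i, (1 / 4 * (k i : ℝ) * (t i - tR d k i) ^ 2 -
    d ^ 2 / 16 * (k i : ℝ) * (rank k - 2 * partialRank k i + k i) ^ 2)

end Exponents

end Wishart

end

/-!
The Fisher metric of the Wishart family is the invariant metric `⟨ξ⁻¹ u ξ⁻¹ | v⟩` of the cone, and
the functions `log |ξ₀⁽ⁱ⁾|` have constant Laplacians and constant, mutually orthogonal gradients for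
it. So `K_t`, the exponential of a linear combination of them, is an eigenfunction.

*The metric.* The substitution `x ↦ a x a` with `a² = ξ` has Jacobian determinant `|ξ| ^ (n / r)`
(`det_conjBy`; unitary diagonalization reduces this to diagonal `a`, where it is read off from a
basis of common eigenvectors, `hasEigenbasis`). It gives the Laplace transform
`∫ |x| ^ s e^(-⟨ξ|x⟩) dx = C |ξ| ^ (-(s + n / r))` on the cone (`laplace_rdet`), which is finite for
all `s > -1` by induction on the size of the matrices (`lintegral_gamma_lt_top`). Hence the
cumulant generating function of `-⟨u|x⟩` under `W_r(μ, ξ)` is `μ log |ξ| - μ log |ξ + t u|`, whose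
second derivative at `0` is the variance of `⟨u|x⟩`. Polarization and division by `μ` give the
metric (`unitFisher_eq`), and the determinant of `u ↦ ξ⁻¹ u ξ⁻¹` gives the Jeffreys density
`|ξ| ^ (-n / r)`; with `∏ᵢ |ξ₀⁽ⁱ⁾| = |ξ|` this is the formula for `K_t`.

*The operator.* If `Φ` is the Euclidean gradient of `φ`, then `W = ξ Φ ξ` is its Riemannian gradient
and `Δ e^φ = (tr DW - (n / r) ⟨ξ⁻¹|W⟩ + ⟨Φ|W⟩) e^φ` in any linear coordinates
(`IsConeMetric.laplaceBeltrami_exp`).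

*The minors.* The Euclidean gradient of the logarithm of the principal minor of `ξ` with index set
`S` is the inverse `A` of that submatrix, padded by zeros. The derivative of `ξ A ξ` is
`u ↦ u - (1 - ξ A) u (1 - ξ A)*`, and `1 - ξ A` is a projection of rank `r - |S|`, similar to a
diagonal one, so all traces are explicit: the Laplacian of the logarithm of a minor of size `m` is
`(d / 2) m (r - m)` (`trace_fderiv_sub_log_corner`). For nested index sets `S ⊆ T` the gradients have
inner product `|S|` (`inner_padInv_conjBy_padInv`). As `|ξ₀⁽ⁱ⁾|` is the quotient of two successive
minors of a nested chain (`rdet_corner_tail`), the gradients of the `log |ξ₀⁽ⁱ⁾|` are orthogonal of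
squared length `k⁽ⁱ⁾`, and the eigenvalue is a quadratic polynomial in the exponents.
-/

noncomputable section

namespace Wishart

universe u

/-! ### Congruences and block decomposition -/

section Conj

variable {𝕜 ι : Type*} [RCLike 𝕜] [Fintype ι] [DecidableEq ι]

@[simp] lemma Herm.mat_neg (x : Herm 𝕜 ι) : (-x).mat = -x.mat := rfl

@[simp] lemma Herm.mat_sub (x y : Herm 𝕜 ι) : (x - y).mat = x.mat - y.mat := rfl

lemma Herm.ext_mat {x y : Herm 𝕜 ι} (h : x.mat = y.mat) : x = y := Herm.mat_injective h

/-- A matrix that equals its conjugate transpose, as an element of the space `Herm 𝕜 ι`. -/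
def Herm.of (a : Matrix ι ι 𝕜) (h : a.conjTranspose = a) : Herm 𝕜 ι := ⟨a, h⟩

@[simp] lemma Herm.mat_of (a : Matrix ι ι 𝕜) (h : a.conjTranspose = a) : (Herm.of a h).mat = a :=
  rfl

/-- The linear map `x ↦ a x a*` on self-adjoint matrices. For self-adjoint `a` this is the
quadratic representation of the Jordan algebra of self-adjoint matrices. -/
def conjBy (a : Matrix ι ι 𝕜) : Herm 𝕜 ι →ₗ[ℝ] Herm 𝕜 ι where
  toFun x := Herm.of (a * x.mat * a.conjTranspose) (by
    simp [Matrix.conjTranspose_mul, x.mat_conjTranspose, Matrix.mul_assoc])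
  map_add' x y := Herm.ext_mat (by simp [mul_add, add_mul])
  map_smul' c x := Herm.ext_mat (by simp)

@[simp] lemma mat_conjBy (a : Matrix ι ι 𝕜) (x : Herm 𝕜 ι) :
    (conjBy a x).mat = a * x.mat * a.conjTranspose := rfl

lemma conjBy_mul (a b : Matrix ι ι 𝕜) : conjBy (a * b) = conjBy a ∘ₗ conjBy b := by
  ext1 x
  exact Herm.ext_mat (by simp [Matrix.conjTranspose_mul, Matrix.mul_assoc])

lemma conjBy_one : conjBy (1 : Matrix ι ι 𝕜) = LinearMap.id := by
  ext1 x
  exact Herm.ext_mat (by simp)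

lemma det_conjBy_mul (a b : Matrix ι ι 𝕜) :
    LinearMap.det (conjBy (a * b)) = LinearMap.det (conjBy a) * LinearMap.det (conjBy b) := by
  rw [conjBy_mul, LinearMap.det_comp]

lemma mem_cone_conjBy_iff {a : Matrix ι ι 𝕜} (ha : IsUnit a) (x : Herm 𝕜 ι) :
    conjBy a x ∈ cone 𝕜 ι ↔ x ∈ cone 𝕜 ι :=
  Matrix.IsUnit.posDef_star_right_conjugate_iff ha

omit [Fintype ι] in
lemma conjTranspose_diagonal_ofReal (δ : ι → ℝ) :
    (Matrix.diagonal fun i => (δ i : 𝕜)).conjTranspose = Matrix.diagonal fun i => (δ i : 𝕜) := by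
  simp [Matrix.diagonal_conjTranspose, Pi.star_def]

lemma conjBy_diagonal_apply (δ : ι → ℝ) (x : Herm 𝕜 ι) (i j : ι) :
    (conjBy (Matrix.diagonal fun i => (δ i : 𝕜)) x).mat i j = δ i * x.mat i j * δ j := by
  rw [mat_conjBy, conjTranspose_diagonal_ofReal, Matrix.mul_diagonal, Matrix.diagonal_mul]

/-- The spectral theorem, with the eigenvalues and the unitary matrix made explicit. -/
lemma exists_unitary_diagonal (x : Herm 𝕜 ι) :
    ∃ (v : Matrix ι ι 𝕜) (δ : ι → ℝ), v * v.conjTranspose = 1 ∧ v.conjTranspose * v = 1 ∧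
      x.mat = v * Matrix.diagonal (fun i => (δ i : 𝕜)) * v.conjTranspose ∧
      (x ∈ cone 𝕜 ι ↔ ∀ i, 0 < δ i) := by
  have hx : x.mat.IsHermitian := x.mat_conjTranspose
  refine ⟨hx.eigenvectorUnitary, hx.eigenvalues, ?_, ?_, ?_, hx.posDef_iff_eigenvalues_pos⟩
  · exact Unitary.mul_star_self_of_mem hx.eigenvectorUnitary.2
  · exact Unitary.star_mul_self_of_mem hx.eigenvectorUnitary.2
  · exact hx.spectral_theorem

end Conj

section Reindex

variable {𝕜 α β : Type*} [RCLike 𝕜] [Fintype α] [DecidableEq α] [Fintype β] [DecidableEq β]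

/-- Renaming the indices of self-adjoint matrices. -/
def Herm.reindex (e : α ≃ β) : Herm 𝕜 α ≃ₗ[ℝ] Herm 𝕜 β where
  toFun x := Herm.of (x.mat.submatrix e.symm e.symm) (by
    rw [Matrix.conjTranspose_submatrix, x.mat_conjTranspose])
  invFun x := Herm.of (x.mat.submatrix e e) (by
    rw [Matrix.conjTranspose_submatrix, x.mat_conjTranspose])
  map_add' _ _ := rfl
  map_smul' _ _ := rfl
  left_inv x := Herm.ext_mat (by simp)
  right_inv x := Herm.ext_mat (by simp)

@[simp] lemma Herm.mat_reindex (e : α ≃ β) (x : Herm 𝕜 α) :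
    (Herm.reindex e x).mat = x.mat.submatrix e.symm e.symm := rfl

lemma reindex_mem_cone (e : α ≃ β) {x : Herm 𝕜 α} (hx : x ∈ cone 𝕜 α) :
    Herm.reindex e x ∈ cone 𝕜 β := Matrix.PosDef.submatrix hx e.symm.injective

end Reindex

section Split

variable {𝕜 : Type*} {ι : Type u} [RCLike 𝕜] [Fintype ι] [DecidableEq ι]

/-- The block decomposition of a self-adjoint matrix `(c, b*; b, y)` into its first diagonal entry
`c`, the rest `b` of its first column and its lower right block `y`. -/
def split : Herm 𝕜 (PUnit.{u + 1} ⊕ ι) ≃ₗ[ℝ] ℝ × (ι → 𝕜) × Herm 𝕜 ι where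
  toFun x := ⟨RCLike.re (x.mat (.inl ⟨⟩) (.inl ⟨⟩)), fun i => x.mat (.inr i) (.inl ⟨⟩),
    Herm.of x.mat.toBlocks₂₂ (by
      ext i j; exact congrFun (congrFun x.mat_conjTranspose (.inr i)) (.inr j))⟩
  invFun z := Herm.of (Matrix.fromBlocks (Matrix.diagonal fun _ => (z.1 : 𝕜))
    (Matrix.replicateCol PUnit z.2.1).conjTranspose (Matrix.replicateCol PUnit z.2.1)
    z.2.2.mat) (by
      rw [Matrix.fromBlocks_conjTranspose, z.2.2.mat_conjTranspose]
      simp)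
  map_add' x y := Prod.ext (by simp) rfl
  map_smul' c x := Prod.ext (by simp [RCLike.smul_re]) rfl
  left_inv x := by
    have h : ∀ p q, star (x.mat p q) = x.mat q p := fun p q =>
      congrFun (congrFun x.mat_conjTranspose q) p
    refine Herm.ext_mat ?_
    ext (⟨⟨⟩⟩ | i) (⟨⟨⟩⟩ | j)
    · simpa using RCLike.conj_eq_iff_re.1 (h (.inl ⟨⟩) (.inl ⟨⟩))
    · exact h _ _
    · rfl
    · rfl
  right_inv z := by
    refine Prod.ext (by simp) (Prod.ext rfl (Herm.ext_mat ?_))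
    ext i j
    rfl

lemma mat_split_symm (z : ℝ × (ι → 𝕜) × Herm 𝕜 ι) :
    (split.symm z).mat = Matrix.fromBlocks (Matrix.diagonal fun _ => (z.1 : 𝕜))
      (Matrix.replicateCol PUnit z.2.1).conjTranspose (Matrix.replicateCol PUnit z.2.1) z.2.2.mat :=
  rfl

/-- A congruence by a real diagonal matrix scales the blocks of `split`. -/
lemma conjBy_diagonal_split_symm (δ : PUnit.{u + 1} ⊕ ι → ℝ) (z : ℝ × (ι → 𝕜) × Herm 𝕜 ι) :
    conjBy (Matrix.diagonal fun i => (δ i : 𝕜)) (split.symm z) =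
      split.symm (δ (.inl ⟨⟩) * δ (.inl ⟨⟩) * z.1, fun i => (δ (.inl ⟨⟩) * δ (.inr i)) • z.2.1 i,
        conjBy (Matrix.diagonal fun i => (δ (.inr i) : 𝕜)) z.2.2) := by
  refine Herm.ext_mat ?_
  ext (⟨⟨⟩⟩ | i) (⟨⟨⟩⟩ | j) <;>
    simp only [conjBy_diagonal_apply, mat_split_symm, Matrix.fromBlocks_apply₁₁,
      Matrix.fromBlocks_apply₁₂, Matrix.fromBlocks_apply₂₁, Matrix.fromBlocks_apply₂₂] <;>
    simp [RCLike.real_smul_eq_coe_mul] <;> ring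

/-- There is a basis of the self-adjoint matrices consisting of common eigenvectors of all
congruences by real diagonal matrices. The `k`-th eigenvalue is `δ (p k) * δ (q k)`; the last clause
counts how often each unordered pair of indices occurs: once if the indices are equal, `d` times
otherwise. -/
def HasEigenbasis (𝕜 : Type*) (ι : Type u) [RCLike 𝕜] [Fintype ι] [DecidableEq ι] : Prop :=
  ∃ (κ : Type u) (_ : Fintype κ) (b : Module.Basis κ ℝ (Herm 𝕜 ι)) (p q : κ → ι),
    (∀ (δ : ι → ℝ) (k : κ), conjBy (Matrix.diagonal fun i => (δ i : 𝕜)) (b k) =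
      (δ (p k) * δ (q k)) • b k) ∧
    ∀ f : ι → ι → ℝ, (∀ i j, f i j = f j i) → ∑ k, f (p k) (q k) =
      (1 - peirceInv 𝕜 / 2) * ∑ i, f i i + peirceInv 𝕜 / 2 * ∑ i, ∑ j, f i j

lemma HasEigenbasis.reindex {α β : Type u} [Fintype α] [DecidableEq α] [Fintype β]
    [DecidableEq β] (e : α ≃ β) (h : HasEigenbasis 𝕜 α) : HasEigenbasis 𝕜 β := by
  obtain ⟨κ, hκ, b, p, q, h1, h2⟩ := h
  refine ⟨κ, hκ, b.map (Herm.reindex e), fun k => e (p k), fun k => e (q k), fun δ k => ?_,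
    fun f hf => ?_⟩
  · rw [Module.Basis.map_apply, ← map_smul, ← h1 (fun i => δ (e i)) k]
    refine Herm.ext_mat ?_
    ext i j
    simp [conjBy_diagonal_apply, -mat_conjBy]
  · rw [h2 (fun i j => f (e i) (e j)) (fun i j => hf _ _), e.sum_comp fun i => f i i]
    congr 2
    rw [← e.sum_comp]
    exact Finset.sum_congr rfl fun i _ => e.sum_comp fun j => f (e i) j

lemma HasEigenbasis.punit_sum (h : HasEigenbasis 𝕜 ι) : HasEigenbasis 𝕜 (PUnit.{u + 1} ⊕ ι) := by
  obtain ⟨κ, hκ, b, p, q, h1, h2⟩ := h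
  refine ⟨PUnit ⊕ (Σ _ : ι, Fin (Module.finrank ℝ 𝕜)) ⊕ κ, inferInstance,
    ((Module.Basis.singleton PUnit ℝ).prod
      ((Pi.basis fun _ : ι => Module.finBasis ℝ 𝕜).prod b)).map split.symm,
    Sum.elim (fun _ => .inl ⟨⟩) (Sum.elim (fun _ => .inl ⟨⟩) fun k => .inr (p k)),
    Sum.elim (fun _ => .inl ⟨⟩) (Sum.elim (fun j => .inr j.1) fun k => .inr (q k)), ?_, ?_⟩
  · rintro δ (⟨⟨⟩⟩ | ⟨i, j⟩ | k)
    · simp only [Module.Basis.map_apply, conjBy_diagonal_split_symm, ← map_smul]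
      congr 1
      simp
      rfl
    · simp only [Module.Basis.map_apply, conjBy_diagonal_split_symm, ← map_smul]
      congr 1
      simp
      ext i'
      by_cases hi : i' = i
      · subst hi
        simp
      · simp [hi]
    · simp only [Module.Basis.map_apply, conjBy_diagonal_split_symm, ← map_smul]
      congr 1
      simp [h1]
      rfl
  · intro f hf
    have := h2 (fun i j => f (.inr i) (.inr j)) fun i j => hf _ _
    simp only [Fintype.sum_sum_type, Sum.elim_inl, Sum.elim_inr, this, Fintype.sum_sigma,
      Finset.sum_const, Finset.card_univ, Fintype.card_fin, Finset.card_singleton, Nat.cast_one,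
      Finset.univ_unique, Finset.sum_singleton, Finset.sum_add_distrib, ← Finset.mul_sum,
      nsmul_eq_mul, hf (.inr _) (.inl _)]
    simp only [peirceInv]
    ring

variable (𝕜 ι) in
lemma hasEigenbasis : HasEigenbasis 𝕜 ι := by
  suffices h : ∀ [DecidableEq ι], HasEigenbasis 𝕜 ι from h
  refine Fintype.induction_empty_option (P := fun ι _ => ∀ [DecidableEq ι], HasEigenbasis 𝕜 ι)
    ?_ ?_ ?_ ι
  · intro α β _ e (ih : ∀ [DecidableEq α], _) _
    classical
    let _ : Fintype α := Fintype.ofEquiv β e.symm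
    exact HasEigenbasis.reindex e (by convert @ih _)
  · intro _
    have : Subsingleton (Herm 𝕜 PEmpty.{u + 1}) :=
      ⟨fun x y => Herm.ext_mat (by ext i; exact i.elim)⟩
    exact ⟨PEmpty, inferInstance, Module.Basis.empty _, PEmpty.elim, PEmpty.elim,
      fun δ k => k.elim, fun f _ => by simp⟩
  · intro ι _ (ih : ∀ [DecidableEq ι], _) _
    classical
    exact HasEigenbasis.reindex ((Equiv.sumComm _ _).trans (Equiv.optionEquivSumPUnit ι).symm)
      (HasEigenbasis.punit_sum (@ih _))

end Split

/-! ### Determinants and traces of congruences, the cone -/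

lemma toMatrix_of_eigenbasis {κ E : Type*} [Fintype κ] [DecidableEq κ] [AddCommGroup E]
    [Module ℝ E] (b : Module.Basis κ ℝ E) {f : E →ₗ[ℝ] E} {c : κ → ℝ}
    (h : ∀ k, f (b k) = c k • b k) : LinearMap.toMatrix b b f = Matrix.diagonal c := by
  ext i j
  rw [LinearMap.toMatrix_apply, h, map_smul, Module.Basis.repr_self, Finsupp.smul_single,
    smul_eq_mul, mul_one, Finsupp.single_apply, Matrix.diagonal_apply]
  grind

section

variable {𝕜 : Type*} {ι : Type u} [RCLike 𝕜] [Fintype ι] [DecidableEq ι]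

lemma trace_conjBy_diagonal (δ : ι → ℝ) :
    LinearMap.trace ℝ _ (conjBy (Matrix.diagonal fun i => (δ i : 𝕜))) =
      (1 - peirceInv 𝕜 / 2) * ∑ i, δ i ^ 2 + peirceInv 𝕜 / 2 * (∑ i, δ i) ^ 2 := by
  classical
  obtain ⟨κ, _, b, p, q, h1, h2⟩ := hasEigenbasis 𝕜 ι
  rw [LinearMap.trace_eq_matrix_trace ℝ b, toMatrix_of_eigenbasis b (h1 δ),
    Matrix.trace_diagonal, h2 (fun i j => δ i * δ j) fun i j => mul_comm _ _, sq (∑ i, δ i),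
    Finset.sum_mul_sum]
  simp only [sq]

lemma det_conjBy_diagonal {δ : ι → ℝ} (hδ : ∀ i, 0 < δ i) :
    LinearMap.det (conjBy (Matrix.diagonal fun i => (δ i : 𝕜))) =
      (∏ i, δ i) ^ (2 * dimRatio 𝕜 ι) := by
  classical
  obtain ⟨κ, _, b, p, q, h1, h2⟩ := hasEigenbasis 𝕜 ι
  have hP : 0 < ∏ i, δ i := Finset.prod_pos fun i _ => hδ i
  rw [← LinearMap.det_toMatrix b, toMatrix_of_eigenbasis b (h1 δ), Matrix.det_diagonal]
  have hQ : 0 < ∏ k, δ (p k) * δ (q k) := Finset.prod_pos fun k _ => mul_pos (hδ _) (hδ _)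
  apply Real.log_injOn_pos hQ (Real.rpow_pos_of_pos hP _)
  rw [Real.log_rpow hP, Real.log_prod fun i _ => (hδ i).ne',
    Real.log_prod fun k _ => (mul_pos (hδ _) (hδ _)).ne',
    h2 (fun i j => Real.log (δ i * δ j)) fun i j => by rw [mul_comm]]
  simp only [Real.log_mul (hδ _).ne' (hδ _).ne', Finset.sum_add_distrib, Finset.sum_const,
    Finset.card_univ, nsmul_eq_mul, ← Finset.mul_sum, dimRatio]
  ring

/-- The determinant of a self-adjoint matrix is real. -/
lemma ofReal_rdet {a : Matrix ι ι 𝕜} (h : a.IsHermitian) : (rdet a : 𝕜) = a.det := by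
  rw [rdet, ← RCLike.conj_eq_iff_re, ← RCLike.star_def, ← Matrix.det_conjTranspose, h.eq]

lemma rdet_eq_prod {v a : Matrix ι ι 𝕜} {δ : ι → ℝ} (hv : v * v.conjTranspose = 1)
    (ha : a = v * Matrix.diagonal (fun i => (δ i : 𝕜)) * v.conjTranspose) :
    rdet a = ∏ i, δ i := by
  have h : v.det * v.conjTranspose.det = 1 := by rw [← Matrix.det_mul, hv, Matrix.det_one]
  rw [rdet, ha, Matrix.det_mul, Matrix.det_mul, mul_right_comm, h, one_mul, Matrix.det_diagonal,
    ← RCLike.ofReal_prod, RCLike.ofReal_re]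

lemma rdet_pos_of_posDef {a : Matrix ι ι 𝕜} (h : a.PosDef) : 0 < rdet a := by
  have := h.det_pos
  rw [← ofReal_rdet h.1] at this
  exact_mod_cast this

lemma rdet_pos {x : Herm 𝕜 ι} (hx : x ∈ cone 𝕜 ι) : 0 < rdet x.mat := rdet_pos_of_posDef hx

lemma isUnit_mat {x : Herm 𝕜 ι} (hx : x ∈ cone 𝕜 ι) : IsUnit x.mat := Matrix.PosDef.isUnit hx

/-- The determinant of the quadratic representation of a positive definite matrix: unitary
diagonalization reduces it to the diagonal case, as the determinants of the congruences by a
unitary matrix and its inverse cancel. -/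
lemma det_conjBy {x : Herm 𝕜 ι} (hx : x ∈ cone 𝕜 ι) :
    LinearMap.det (conjBy x.mat) = rdet x.mat ^ (2 * dimRatio 𝕜 ι) := by
  obtain ⟨v, δ, h1, h2, h3, h4⟩ := exists_unitary_diagonal x
  have h : LinearMap.det (conjBy v) * LinearMap.det (conjBy v.conjTranspose) = 1 := by
    rw [← det_conjBy_mul, h1, conjBy_one, LinearMap.det_id]
  rw [rdet_eq_prod h1 h3, h3, det_conjBy_mul, det_conjBy_mul, mul_right_comm, h, one_mul,
    det_conjBy_diagonal (h4.1 hx)]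

lemma exists_sqrt {x : Herm 𝕜 ι} (hx : x ∈ cone 𝕜 ι) :
    ∃ a ∈ cone 𝕜 ι, a.mat * a.mat = x.mat := by
  obtain ⟨v, δ, h1, h2, h3, h4⟩ := exists_unitary_diagonal x
  have hδ := h4.1 hx
  have hv : IsUnit v := IsUnit.of_mul_eq_one _ h1
  refine ⟨conjBy v (Herm.of (Matrix.diagonal fun i => (√(δ i) : 𝕜))
    (conjTranspose_diagonal_ofReal _)), ?_, ?_⟩
  · rw [mem_cone_conjBy_iff hv]
    exact Matrix.PosDef.diagonal fun i => by
      simpa using hδ i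
  · rw [mat_conjBy, Herm.mat_of, h3]
    calc _ = v * (Matrix.diagonal fun i => (√(δ i) : 𝕜)) * (v.conjTranspose * v) *
          (Matrix.diagonal fun i => (√(δ i) : 𝕜)) * v.conjTranspose := by
            simp only [Matrix.mul_assoc]
      _ = _ := by
        rw [h2, mul_one, Matrix.mul_assoc v, Matrix.diagonal_mul_diagonal]
        simp only [← RCLike.ofReal_mul, Real.mul_self_sqrt (hδ _).le]

lemma rdet_mul_self {a : Herm 𝕜 ι} : rdet (a.mat * a.mat) = rdet a.mat ^ 2 := by
  have h := ofReal_rdet a.mat_conjTranspose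
  rw [rdet, Matrix.det_mul, ← h, ← RCLike.ofReal_mul, RCLike.ofReal_re, sq]

lemma rdet_conjBy (a x : Herm 𝕜 ι) :
    rdet (conjBy a.mat x).mat = rdet a.mat ^ 2 * rdet x.mat := by
  have h := ofReal_rdet a.mat_conjTranspose
  rw [rdet, mat_conjBy, a.mat_conjTranspose, Matrix.det_mul, Matrix.det_mul, ← h,
    ← ofReal_rdet x.mat_conjTranspose, ← RCLike.ofReal_mul, ← RCLike.ofReal_mul, RCLike.ofReal_re]
  ring

/-- The eigenvalues of `w` are at most `‖w‖` in absolute value, as `‖w‖²` is the sum of their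
squares. -/
lemma one_add_mem_cone {w : Herm 𝕜 ι} (hw : ‖w‖ < 1) :
    Herm.of 1 Matrix.conjTranspose_one + w ∈ cone 𝕜 ι := by
  obtain ⟨v, δ, h1, h2, h3, -⟩ := exists_unitary_diagonal w
  have hv : IsUnit v := IsUnit.of_mul_eq_one _ h1
  have hn : ∑ i, δ i ^ 2 = ‖w‖ ^ 2 := by
    rw [← real_inner_self_eq_norm_sq, Herm.inner_eq, h3]
    calc _ = RCLike.re (Matrix.diagonal (fun i => (δ i : 𝕜)) *
          Matrix.diagonal (fun i => (δ i : 𝕜))).trace := by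
            rw [Matrix.diagonal_mul_diagonal, Matrix.trace_diagonal]
            simp only [← RCLike.ofReal_mul, ← RCLike.ofReal_sum, RCLike.ofReal_re, sq]
      _ = RCLike.re ((v.conjTranspose * v) * Matrix.diagonal (fun i => (δ i : 𝕜)) *
          ((v.conjTranspose * v) * Matrix.diagonal (fun i => (δ i : 𝕜)))).trace := by
            rw [h2, one_mul]
      _ = _ := by
        simp only [Matrix.mul_assoc]
        rw [Matrix.trace_mul_comm v.conjTranspose]
        simp only [Matrix.mul_assoc]
  have hδ : ∀ i, 0 < 1 + δ i := fun i => by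
    have h : δ i ^ 2 ≤ ‖w‖ ^ 2 := hn ▸ Finset.single_le_sum (f := fun i => δ i ^ 2)
      (fun i _ => sq_nonneg _) (Finset.mem_univ i)
    have := abs_le_of_sq_le_sq h (norm_nonneg _)
    linarith [neg_abs_le (δ i)]
  have : Herm.of 1 Matrix.conjTranspose_one + w = conjBy v (Herm.of
      (Matrix.diagonal fun i => ((1 + δ i : ℝ) : 𝕜)) (conjTranspose_diagonal_ofReal _)) := by
    refine Herm.ext_mat ?_
    have hd : (Matrix.diagonal fun i => ((1 + δ i : ℝ) : 𝕜)) =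
        1 + Matrix.diagonal fun i => (δ i : 𝕜) := by
      rw [← Matrix.diagonal_one, Matrix.diagonal_add]
      simp
    rw [mat_conjBy, Herm.mat_of, hd, mul_add, add_mul, ← h3, mul_one, h1]
    rfl
  rw [this, mem_cone_conjBy_iff hv]
  exact Matrix.PosDef.diagonal fun i => by exact_mod_cast hδ i

variable (𝕜 ι) in
/-- For `ξ = a²`, the congruence by `a⁻¹` moves `ξ` to the identity, a unit ball around which lies in
the cone. -/
lemma isOpen_cone : IsOpen (cone 𝕜 ι) := by
  rw [isOpen_iff_mem_nhds]
  intro x hx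
  obtain ⟨a, ha, hax⟩ := exists_sqrt hx
  have hu := isUnit_mat ha
  have hu' := (Matrix.isUnit_iff_isUnit_det _).1 hu
  set L := conjBy (a.mat)⁻¹ with hL
  have hc : Continuous fun y => ‖L (y - x)‖ :=
    ((LinearMap.continuous_of_finiteDimensional L).comp (continuous_id.sub continuous_const)).norm
  have h0 : ∀ᶠ y in nhds x, ‖L (y - x)‖ < 1 :=
    hc.continuousAt.eventually_lt continuousAt_const (by simp)
  filter_upwards [h0] with y hy
  have h1 := (mem_cone_conjBy_iff hu _).2 (one_add_mem_cone hy)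
  convert h1 using 1
  rw [map_add, hL, ← LinearMap.comp_apply, ← conjBy_mul, Matrix.mul_nonsing_inv _ hu', conjBy_one]
  refine Herm.ext_mat ?_
  simp [a.mat_conjTranspose, hax]

lemma one_mem_cone : Herm.of 1 Matrix.conjTranspose_one ∈ cone 𝕜 ι := by
  exact Matrix.PosDef.one

/-- The inverse of a self-adjoint matrix. -/
def Herm.inv (x : Herm 𝕜 ι) : Herm 𝕜 ι := Herm.of (x.mat)⁻¹ (by
  rw [Matrix.conjTranspose_nonsing_inv, x.mat_conjTranspose])

@[simp] lemma Herm.mat_inv (x : Herm 𝕜 ι) : x.inv.mat = (x.mat)⁻¹ := rfl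

lemma inv_mem_cone {x : Herm 𝕜 ι} (hx : x ∈ cone 𝕜 ι) : x.inv ∈ cone 𝕜 ι := Matrix.PosDef.inv hx

lemma rdet_inv {x : Herm 𝕜 ι} (hx : x ∈ cone 𝕜 ι) : rdet x.inv.mat = (rdet x.mat)⁻¹ := by
  have h : x.mat * x.inv.mat = 1 :=
    Matrix.mul_nonsing_inv _ ((Matrix.isUnit_iff_isUnit_det _).1 (isUnit_mat hx))
  have h2 := congrArg Matrix.det h
  rw [Matrix.det_mul, ← ofReal_rdet x.mat_conjTranspose, ← ofReal_rdet x.inv.mat_conjTranspose,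
    Matrix.det_one] at h2
  exact eq_inv_of_mul_eq_one_right (by exact_mod_cast h2)

end

/-! ### Convergence of the multivariate gamma integral -/

section

open MeasureTheory

/-- Finiteness of an integral does not depend on the linear coordinates. -/
lemma lintegral_comp_linearEquiv_lt_top {E F : Type*} [NormedAddCommGroup E] [NormedSpace ℝ E]
    [FiniteDimensional ℝ E] [MeasurableSpace E] [BorelSpace E] [NormedAddCommGroup F]
    [NormedSpace ℝ F] [FiniteDimensional ℝ F] [MeasurableSpace F] [BorelSpace F]
    (μ : Measure E) [μ.IsAddHaarMeasure] (ν : Measure F) [ν.IsAddHaarMeasure] (e : E ≃ₗ[ℝ] F)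
    {f : F → ENNReal} (hf : ∫⁻ y, f y ∂ν < ⊤) : ∫⁻ x, f (e x) ∂μ < ⊤ := by
  let e' : E ≃L[ℝ] F := e.toContinuousLinearEquiv
  have : (μ.map e').IsAddHaarMeasure := e'.isAddHaarMeasure_map μ
  have h : ∫⁻ x, f (e x) ∂μ = ∫⁻ y, f y ∂(μ.map e') :=
    (lintegral_map_equiv f e'.toHomeomorph.toMeasurableEquiv).symm
  rw [h, Measure.isAddLeftInvariant_eq_smul (μ.map e') ν, lintegral_smul_measure]
  exact ENNReal.mul_lt_top ENNReal.coe_lt_top hf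

/-- The integral behind the recursion of the multivariate gamma function: integrating out `y`
(by translation invariance), then the Gaussian variable `b`, leaves a gamma integral in `c`. -/
lemma lintegral_gauss_shear_lt_top {V E : Type*} [NormedAddCommGroup V] [InnerProductSpace ℝ V]
    [FiniteDimensional ℝ V] [MeasurableSpace V] [BorelSpace V] [NormedAddCommGroup E]
    [InnerProductSpace ℝ E] [FiniteDimensional ℝ E] [MeasurableSpace E] [BorelSpace E] {s : ℝ}
    (hs : -1 < s) (q : ℝ → V → E) {G : E → ENNReal} (hG : ∫⁻ y, G y < ⊤) :
    ∫⁻ z : ℝ × V × E, (Set.Ioi (0 : ℝ)).indicator (fun c => ENNReal.ofReal (c ^ s * Real.exp (-c)))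
      z.1 * ENNReal.ofReal (Real.exp (-z.1⁻¹ * ‖z.2.1‖ ^ 2)) * G (z.2.2 - q z.1 z.2.1) < ⊤ := by
  set N : ℝ := (Module.finrank ℝ V : ℝ)
  have hN : 0 ≤ N := Nat.cast_nonneg _
  set J := ∫⁻ y, G y
  have hgauss : ∀ c : ℝ, 0 < c → ∫⁻ b : V, ENNReal.ofReal (Real.exp (-c⁻¹ * ‖b‖ ^ 2)) =
      ENNReal.ofReal ((Real.pi * c) ^ (N / 2)) := by
    intro c hc
    have h := GaussianFourier.integral_rexp_neg_mul_sq_norm (V := V) (inv_pos.2 hc)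
    rw [div_inv_eq_mul] at h
    rw [← ofReal_integral_eq_lintegral_ofReal _ (.of_forall fun _ => (Real.exp_pos _).le), h]
    by_contra hi
    rw [integral_undef hi] at h
    exact (Real.rpow_pos_of_pos (mul_pos Real.pi_pos hc) (N / 2)).ne h
  have hgamma : ∫⁻ c in Set.Ioi (0 : ℝ), ENNReal.ofReal
      (Real.exp (-c) * c ^ (s + N / 2 + 1 - 1)) < ⊤ :=
    (Real.GammaIntegral_convergent (by linarith)).lintegral_lt_top
  refine (lintegral_prod_le _).trans_lt ?_
  refine (lintegral_mono fun c => lintegral_prod_le _).trans_lt ?_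
  have hle : ∀ c : ℝ, ∫⁻ b : V, ∫⁻ y : E, (Set.Ioi (0 : ℝ)).indicator
      (fun c => ENNReal.ofReal (c ^ s * Real.exp (-c))) c *
        ENNReal.ofReal (Real.exp (-c⁻¹ * ‖b‖ ^ 2)) * G (y - q c b) =
      (ENNReal.ofReal (Real.pi ^ (N / 2)) * J) * (Set.Ioi (0 : ℝ)).indicator (fun c =>
        ENNReal.ofReal (Real.exp (-c) * c ^ (s + N / 2 + 1 - 1))) c := by
    intro c
    by_cases hc : c ∈ Set.Ioi (0 : ℝ)
    · have hc' : 0 < c := hc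
      simp only [Set.indicator_of_mem hc]
      calc _ = ∫⁻ b : V, (ENNReal.ofReal (c ^ s * Real.exp (-c)) * J) *
            ENNReal.ofReal (Real.exp (-c⁻¹ * ‖b‖ ^ 2)) := by
              refine lintegral_congr fun b => ?_
              rw [lintegral_const_mul' _ _ (ENNReal.mul_ne_top ENNReal.ofReal_ne_top
                ENNReal.ofReal_ne_top), lintegral_sub_right_eq_self G (q c b)]
              ring
        _ = _ := by
          rw [lintegral_const_mul' _ _ (ENNReal.mul_ne_top ENNReal.ofReal_ne_top hG.ne),
            hgauss c hc', mul_right_comm, ← ENNReal.ofReal_mul (by positivity),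
            mul_right_comm (ENNReal.ofReal (Real.pi ^ (N / 2))),
            ← ENNReal.ofReal_mul (by positivity), Real.mul_rpow Real.pi_pos.le hc'.le]
          congr 2
          rw [add_sub_cancel_right, Real.rpow_add hc']
          ring
    · simp [Set.indicator_of_notMem hc]
  simp only [hle]
  rw [lintegral_const_mul' _ _ (ENNReal.mul_ne_top ENNReal.ofReal_ne_top hG.ne),
    lintegral_indicator measurableSet_Ioi]
  exact ENNReal.mul_lt_top (ENNReal.mul_lt_top ENNReal.ofReal_lt_top hG) hgamma

section

variable {𝕜 : Type*} {ι : Type u} [RCLike 𝕜] [Fintype ι] [DecidableEq ι]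

/-- The rank one matrix `c⁻¹ b b*`. -/
def outer (c : ℝ) (b : ι → 𝕜) : Herm 𝕜 ι :=
  Herm.of (c⁻¹ • Matrix.vecMulVec b (star b)) (by
    simp [Matrix.conjTranspose_smul, Matrix.conjTranspose_vecMulVec])

lemma trace_outer (c : ℝ) (b : EuclideanSpace 𝕜 ι) :
    RCLike.re (outer c b.ofLp).mat.trace = c⁻¹ * ‖b‖ ^ 2 := by
  simp only [outer, Herm.mat_of, Matrix.trace, Matrix.diag_apply, Matrix.smul_apply,
    Matrix.vecMulVec_apply, EuclideanSpace.norm_sq_eq, map_sum, Finset.mul_sum, RCLike.smul_re]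
  refine Finset.sum_congr rfl fun i _ => ?_
  simp [RCLike.mul_conj]

/-- Positivity and the determinant in terms of the Schur complement of the first diagonal entry. -/
lemma split_symm_mem_cone {c : ℝ} {b : ι → 𝕜} {y : Herm 𝕜 ι}
    (h : split.symm (c, b, y) ∈ cone 𝕜 (PUnit.{u + 1} ⊕ ι)) :
    0 < c ∧ y - outer c b ∈ cone 𝕜 ι ∧
      rdet (split.symm (c, b, y)).mat = c * rdet (y - outer c b).mat := by
  have hc : 0 < c := by
    have := Matrix.PosDef.diag_pos (A := (split.symm (c, b, y)).mat) h (i := .inl ⟨⟩)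
    rw [mat_split_symm] at this
    simpa using this
  have hc' : (c : 𝕜) ≠ 0 := by exact_mod_cast hc.ne'
  set B := Matrix.replicateCol PUnit.{u + 1} b with hB
  set A : Matrix PUnit.{u + 1} PUnit.{u + 1} 𝕜 := Matrix.diagonal fun _ => (c : 𝕜) with hA
  have hAi : A * Matrix.diagonal (fun _ => (c : 𝕜)⁻¹) = 1 := by
    simp [hA, hc']
  let _ : Invertible A := invertibleOfRightInverse A _ hAi
  have hsch : y.mat - B * ⅟A * B.conjTranspose = (y - outer c b).mat := by
    rw [invOf_eq_right_inv hAi]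
    ext i j
    simp [outer, hB, Matrix.mul_apply, Matrix.vecMulVec_apply, RCLike.real_smul_eq_coe_mul]
    ring
  have hm : (split.symm (c, b, y)).mat = Matrix.fromBlocks A B.conjTranspose B y.mat := rfl
  refine ⟨hc, ?_, ?_⟩
  · -- Block elimination: the congruence by `l` makes the matrix block diagonal.
    set l := Matrix.fromBlocks (1 : Matrix PUnit.{u + 1} PUnit.{u + 1} 𝕜) 0 (-(B * ⅟A))
      (1 : Matrix ι ι 𝕜) with hl
    have hlu : IsUnit l := by
      rw [Matrix.isUnit_iff_isUnit_det, hl, Matrix.det_fromBlocks_zero₁₂]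
      simp
    have h1 : Matrix.PosDef (conjBy l (split.symm (c, b, y))).mat :=
      (mem_cone_conjBy_iff hlu _).2 h
    have h2 : (conjBy l (split.symm (c, b, y))).mat.submatrix Sum.inr Sum.inr =
        (y - outer c b).mat := by
      have hz : -(B * ⅟A) * A + (1 : Matrix ι ι 𝕜) * B = 0 := by
        rw [Matrix.neg_mul, Matrix.mul_assoc, invOf_mul_self, Matrix.mul_one, Matrix.one_mul,
          neg_add_cancel]
      rw [← hsch, mat_conjBy, hm, hl, Matrix.fromBlocks_conjTranspose, Matrix.fromBlocks_multiply,
        Matrix.fromBlocks_multiply, hz]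
      ext i j
      simp only [Matrix.submatrix_apply, Matrix.fromBlocks_apply₂₂, Matrix.zero_mul, zero_add,
        Matrix.conjTranspose_one, Matrix.mul_one, Matrix.one_mul, Matrix.neg_mul, neg_add_eq_sub]
    have h3 := h1.submatrix (e := Sum.inr) Sum.inr_injective
    rwa [h2] at h3
  · rw [rdet, hm, Matrix.det_fromBlocks₁₁, hsch, rdet, hA, Matrix.det_diagonal]
    simp

/-- Siegel's gamma integral converges for exponents greater than `-1`, by induction on the size of
the matrices. The bound on the exponent does not depend on the size. -/
lemma lintegral_gamma_lt_top (ι : Type u) [Fintype ι] [DecidableEq ι] {s : ℝ} (hs : -1 < s) :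
    ∫⁻ x, (cone 𝕜 ι).indicator (fun x => ENNReal.ofReal
      (rdet x.mat ^ s * Real.exp (-RCLike.re x.mat.trace))) x < ⊤ := by
  have reindex : ∀ (α β : Type u) [Fintype α] [DecidableEq α] [Fintype β] [DecidableEq β]
      (e : β ≃ α), (∫⁻ x, (cone 𝕜 α).indicator (fun x => ENNReal.ofReal
        (rdet x.mat ^ s * Real.exp (-RCLike.re x.mat.trace))) x < ⊤) →
      ∫⁻ x, (cone 𝕜 β).indicator (fun x => ENNReal.ofReal
        (rdet x.mat ^ s * Real.exp (-RCLike.re x.mat.trace))) x < ⊤ := by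
    intro α β _ _ _ _ e h
    refine lt_of_le_of_lt (lintegral_mono (fun x => ?_))
      (lintegral_comp_linearEquiv_lt_top volume volume (Herm.reindex e) h)
    by_cases hx : x ∈ cone 𝕜 β
    swap
    · simp [Set.indicator_of_notMem hx]
    rw [Set.indicator_of_mem hx, Set.indicator_of_mem (reindex_mem_cone e hx)]
    apply le_of_eq
    simp only [rdet, Herm.mat_reindex, Matrix.det_submatrix_equiv_self, Matrix.trace,
      Matrix.diag_apply, Matrix.submatrix_apply]
    rw [e.symm.sum_comp fun i => x.mat i i]
  suffices h : ∀ [DecidableEq ι], ∫⁻ x, (cone 𝕜 ι).indicator (fun x => ENNReal.ofReal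
      (rdet x.mat ^ s * Real.exp (-RCLike.re x.mat.trace))) x < ⊤ from h
  refine Fintype.induction_empty_option (P := fun ι _ => ∀ [DecidableEq ι],
    ∫⁻ x, (cone 𝕜 ι).indicator (fun x => ENNReal.ofReal
      (rdet x.mat ^ s * Real.exp (-RCLike.re x.mat.trace))) x < ⊤) ?_ ?_ ?_ ι
  · intro α β _ e (ih : ∀ [DecidableEq α], _) _
    classical
    exact @reindex α β (Fintype.ofEquiv β e.symm) _ _ _ e.symm ih
  · intro _
    have hsub : Subsingleton (Herm 𝕜 PEmpty.{u + 1}) :=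
      ⟨fun x y => Herm.ext_mat (by ext i; exact i.elim)⟩
    refine lt_of_le_of_lt (lintegral_mono (g := fun _ => 1) (fun x => ?_)) ?_
    · exact Set.indicator_apply_le' (fun _ => by simp [rdet, Matrix.trace]) fun _ => zero_le
    · rw [lintegral_one]
      exact (Set.subsingleton_univ.finite.isCompact).measure_lt_top
  · intro ι _ (ih : ∀ [DecidableEq ι], _) _
    classical
    refine reindex (PUnit.{u + 1} ⊕ ι) (Option ι)
      ((Equiv.optionEquivSumPUnit ι).trans (Equiv.sumComm _ _)) ?_
    -- There is no measurable structure on a general `𝕜`, so none on the space of columns.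
    let _ : MeasurableSpace (EuclideanSpace 𝕜 ι) := borel _
    have : BorelSpace (EuclideanSpace 𝕜 ι) := ⟨rfl⟩
    let e : Herm 𝕜 (PUnit.{u + 1} ⊕ ι) ≃ₗ[ℝ] ℝ × EuclideanSpace 𝕜 ι × Herm 𝕜 ι :=
      split ≪≫ₗ (LinearEquiv.refl ℝ ℝ).prodCongr
        ((WithLp.linearEquiv 2 ℝ (ι → 𝕜)).symm.prodCongr (LinearEquiv.refl ℝ _))
    have hV : ((volume : Measure (EuclideanSpace 𝕜 ι)).prod
        (volume : Measure (Herm 𝕜 ι))).IsAddHaarMeasure := Measure.prod.instIsAddHaarMeasure _ _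
    have hR : ((volume : Measure ℝ).prod ((volume : Measure (EuclideanSpace 𝕜 ι)).prod
        (volume : Measure (Herm 𝕜 ι)))).IsAddHaarMeasure := Measure.prod.instIsAddHaarMeasure _ _
    refine lt_of_le_of_lt (lintegral_mono fun x => ?_)
      (lintegral_comp_linearEquiv_lt_top volume (volume.prod (volume.prod volume)) e
        (lintegral_gauss_shear_lt_top (V := EuclideanSpace 𝕜 ι) hs
          (fun c b => outer c b.ofLp) (@ih _)))
    by_cases hx : x ∈ cone 𝕜 (PUnit.{u + 1} ⊕ ι)
    swap
    · simp [Set.indicator_of_notMem hx]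
    obtain ⟨⟨c, b, y⟩, rfl⟩ := split.symm.surjective x
    have he : e (split.symm (c, b, y)) = (c, WithLp.toLp 2 b, y) := by simp [e]
    obtain ⟨hc, hy, hdet⟩ := split_symm_mem_cone hx
    have htr : RCLike.re (split.symm (c, b, y)).mat.trace =
        c + (c⁻¹ * ‖WithLp.toLp 2 b‖ ^ 2 + RCLike.re (y - outer c b).mat.trace) := by
      rw [← trace_outer c (WithLp.toLp 2 b), mat_split_symm]
      simp [Matrix.trace, Fintype.sum_sum_type]
    rw [Set.indicator_of_mem hx, he]
    simp only
    rw [Set.indicator_of_mem (Set.mem_Ioi.2 hc), Set.indicator_of_mem hy, hdet, htr,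
      ← ENNReal.ofReal_mul (by positivity), ← ENNReal.ofReal_mul (by positivity),
      Real.mul_rpow hc.le (rdet_pos hy).le, neg_add, neg_add, Real.exp_add, Real.exp_add, neg_mul]
    exact le_of_eq (congrArg _ (by ring))

end

end

/-! ### Derivatives of the determinant and the inverse -/

section

variable {𝕜 : Type*} {ι : Type u} [RCLike 𝕜] [Fintype ι] [DecidableEq ι]

variable (𝕜 ι) in
/-- `Herm.mat` as a real linear map. -/
def Herm.matLin : Herm 𝕜 ι →ₗ[ℝ] Matrix ι ι 𝕜 where
  toFun := Herm.mat
  map_add' _ _ := rfl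
  map_smul' _ _ := rfl

lemma continuous_mat : Continuous (Herm.mat : Herm 𝕜 ι → Matrix ι ι 𝕜) :=
  LinearMap.continuous_of_finiteDimensional (Herm.matLin 𝕜 ι)

lemma contDiff_rdet : ContDiff ℝ ∞ fun x : Herm 𝕜 ι => rdet x.mat := by
  have hentry : ∀ i j, ContDiff ℝ ∞ fun x : Herm 𝕜 ι => x.mat i j := fun i j =>
    (LinearMap.toContinuousLinearMap
      ((Matrix.entryLinearMap ℝ 𝕜 i j) ∘ₗ Herm.matLin 𝕜 ι)).contDiff
  have h : ContDiff ℝ ∞ fun x : Herm 𝕜 ι => x.mat.det := by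
    simp only [Matrix.det_apply']
    exact ContDiff.sum fun σ _ => contDiff_const.mul (contDiff_prod fun i _ => hentry _ _)
  exact (RCLike.reCLM (K := 𝕜)).contDiff.comp h

lemma mul_inv_mat {x : Herm 𝕜 ι} (hx : x ∈ cone 𝕜 ι) : x.mat * x.inv.mat = 1 :=
  Matrix.mul_nonsing_inv _ ((Matrix.isUnit_iff_isUnit_det _).1 (isUnit_mat hx))

lemma inv_mat_mul {x : Herm 𝕜 ι} (hx : x ∈ cone 𝕜 ι) : x.inv.mat * x.mat = 1 :=
  Matrix.nonsing_inv_mul _ ((Matrix.isUnit_iff_isUnit_det _).1 (isUnit_mat hx))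

/-- Jacobi's formula along a line. -/
lemma hasDerivAt_rdet_line {x : Herm 𝕜 ι} (hx : x ∈ cone 𝕜 ι) (u : Herm 𝕜 ι) :
    HasDerivAt (fun t : ℝ => rdet (x + t • u).mat) (rdet x.mat * inner ℝ x.inv u) 0 := by
  set M := x.inv.mat * u.mat with hM
  set q : Polynomial 𝕜 := (1 + (Polynomial.X : Polynomial 𝕜) • M.map Polynomial.C).det with hq
  have hq' : HasDerivAt (fun z : 𝕜 => q.eval z) M.trace 0 := by
    have := q.hasDerivAt (0 : 𝕜)
    rwa [hq, Matrix.derivative_det_one_add_X_smul] at this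
  have h1 : HasDerivAt (fun t : ℝ => q.eval (t : 𝕜)) M.trace 0 := by
    have h0 : HasDerivAt (fun t : ℝ => (t : 𝕜)) 1 0 := by
      simpa using (RCLike.ofRealCLM (K := 𝕜)).hasDerivAt (x := 0)
    have h3 : HasDerivAt (fun z : 𝕜 => q.eval z) M.trace ((0 : ℝ) : 𝕜) := by simpa using hq'
    have h4 := HasDerivAt.scomp (𝕜 := ℝ) (0 : ℝ) h3 h0
    rw [one_smul] at h4
    exact h4
  have h2 : HasDerivAt (fun t : ℝ => RCLike.re (q.eval (t : 𝕜))) (RCLike.re M.trace) 0 := by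
    exact (RCLike.reCLM (K := 𝕜)).hasFDerivAt.comp_hasDerivAt (0 : ℝ) h1
  refine (h2.const_mul (rdet x.mat)).congr_of_eventuallyEq (.of_forall fun t => ?_)
  have hd : (x + t • u).mat = x.mat * (1 + (t : 𝕜) • M) := by
    rw [hM, mul_add, Matrix.mul_smul, ← mul_assoc, mul_inv_mat hx, mul_one, one_mul]
    ext i j
    simp [RCLike.real_smul_eq_coe_mul]
  have he : (1 + (t : 𝕜) • M).det = q.eval (t : 𝕜) := by
    rw [hq, ← Polynomial.coe_evalRingHom, RingHom.map_det]
    congr 1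
    ext i j
    simp only [Matrix.add_apply, Matrix.one_apply, Matrix.smul_apply, RingHom.mapMatrix_apply,
      Matrix.map_apply, smul_eq_mul, Polynomial.coe_evalRingHom, Polynomial.eval_add,
      Polynomial.eval_mul, Polynomial.eval_X, Polynomial.eval_C]
    split_ifs <;> simp
  change rdet (x + t • u).mat = rdet x.mat * RCLike.re (q.eval (t : 𝕜))
  rw [rdet, hd, Matrix.det_mul, he, ← ofReal_rdet x.mat_conjTranspose, RCLike.re_ofReal_mul]

lemma hasFDerivAt_log_rdet {x : Herm 𝕜 ι} (hx : x ∈ cone 𝕜 ι) :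
    HasFDerivAt (fun x : Herm 𝕜 ι => Real.log (rdet x.mat)) (innerSL ℝ x.inv) x := by
  have hd : DifferentiableAt ℝ (fun x : Herm 𝕜 ι => rdet x.mat) x :=
    contDiff_rdet.differentiable (by simp) x
  refine (hd.hasFDerivAt.log (rdet_pos hx).ne').congr_fderiv ?_
  refine ContinuousLinearMap.ext fun u => ?_
  have h1 := (hd.hasFDerivAt.hasLineDerivAt u)
  have h2 := h1.unique (hasDerivAt_rdet_line hx u)
  rw [smul_apply, h2, smul_eq_mul, inv_mul_cancel_left₀ (rdet_pos hx).ne']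
  rfl

/-- The projection of matrices onto their self-adjoint part. -/
def selfAdjointPartLin : Matrix ι ι 𝕜 →ₗ[ℝ] Herm 𝕜 ι where
  toFun a := Herm.of ((1 / 2 : ℝ) • (a + a.conjTranspose)) (by
    simp [Matrix.conjTranspose_smul, add_comm])
  map_add' a b := Herm.ext_mat (by
    simp only [Herm.mat_of, Herm.mat_add, Matrix.conjTranspose_add, ← smul_add]; abel_nf)
  map_smul' c a := Herm.ext_mat (by
    simp [Matrix.conjTranspose_smul, ← smul_add, smul_comm c])

lemma selfAdjointPartLin_mat (x : Herm 𝕜 ι) : selfAdjointPartLin x.mat = x := Herm.ext_mat (by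
  change (1 / 2 : ℝ) • (x.mat + x.mat.conjTranspose) = x.mat
  rw [x.mat_conjTranspose, ← two_smul ℝ, smul_smul]
  norm_num)

open scoped Matrix.Norms.Operator in
/-- The inverse on `Herm 𝕜 ι` is the inverse of the normed ring of matrices, followed by the linear
projection `selfAdjointPartLin`. -/
lemma hasFDerivAt_inv {x : Herm 𝕜 ι} (hx : x ∈ cone 𝕜 ι) :
    HasFDerivAt (Herm.inv : Herm 𝕜 ι → Herm 𝕜 ι)
      (-(LinearMap.toContinuousLinearMap (conjBy x.inv.mat))) x := by
  obtain ⟨U, hU⟩ := isUnit_mat hx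
  have hUi : ((U⁻¹ : (Matrix ι ι 𝕜)ˣ) : Matrix ι ι 𝕜) = x.inv.mat := by
    rw [Herm.mat_inv, ← hU, Matrix.coe_units_inv]
  have h1 := (hasFDerivAt_ringInverse (𝕜 := ℝ) U)
  rw [hU] at h1
  have h2 := (LinearMap.toContinuousLinearMap
    (selfAdjointPartLin (𝕜 := 𝕜) (ι := ι))).hasFDerivAt.comp x
      (h1.comp x (LinearMap.toContinuousLinearMap (Herm.matLin 𝕜 ι)).hasFDerivAt)
  refine (h2.congr_fderiv ?_).congr_of_eventuallyEq (.of_forall fun y => ?_)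
  · refine ContinuousLinearMap.ext fun u => ?_
    change selfAdjointPartLin (-(((U⁻¹ : (Matrix ι ι 𝕜)ˣ) : Matrix ι ι 𝕜) * u.mat *
      ((U⁻¹ : (Matrix ι ι 𝕜)ˣ) : Matrix ι ι 𝕜))) =
      -conjBy x.inv.mat u
    rw [← selfAdjointPartLin_mat (-conjBy x.inv.mat u), Herm.mat_neg, mat_conjBy,
      x.inv.mat_conjTranspose, hUi]
  · change y.inv = selfAdjointPartLin (Ring.inverse y.mat)
    rw [← Matrix.nonsing_inv_eq_ringInverse]
    exact (selfAdjointPartLin_mat y.inv).symm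

end

/-! ### The Fisher metric of the Wishart family -/

section

open MeasureTheory ProbabilityTheory

section

variable {𝕜 : Type*} {ι : Type u} [RCLike 𝕜] [Fintype ι] [DecidableEq ι]

lemma measurableSet_cone : MeasurableSet (cone 𝕜 ι) := (isOpen_cone 𝕜 ι).measurableSet

lemma continuousOn_rdet_rpow (s : ℝ) :
    ContinuousOn (fun x : Herm 𝕜 ι => rdet x.mat ^ s) (cone 𝕜 ι) :=
  contDiff_rdet.continuous.continuousOn.rpow_const fun _ hx => .inl (rdet_pos hx).ne'

lemma integrableOn_gamma {s : ℝ} (hs : -1 < s) :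
    IntegrableOn (fun x : Herm 𝕜 ι => rdet x.mat ^ s * Real.exp (-RCLike.re x.mat.trace))
      (cone 𝕜 ι) := by
  have hc : Continuous fun x : Herm 𝕜 ι => Real.exp (-RCLike.re x.mat.trace) :=
    Real.continuous_exp.comp
      ((RCLike.continuous_re.comp (continuous_mat.matrix_trace)).neg)
  refine ⟨((continuousOn_rdet_rpow s).mul hc.continuousOn).aestronglyMeasurable
    measurableSet_cone, ?_⟩
  rw [hasFiniteIntegral_iff_ofReal, ← lintegral_indicator measurableSet_cone]
  · exact lintegral_gamma_lt_top ι hs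
  · filter_upwards [ae_restrict_mem measurableSet_cone] with x hx
    have := rdet_pos hx
    positivity

lemma inner_mul_self_eq (a x : Herm 𝕜 ι) {ξ : Herm 𝕜 ι} (h : a.mat * a.mat = ξ.mat) :
    inner ℝ ξ x = RCLike.re (conjBy a.mat x).mat.trace := by
  rw [Herm.inner_eq, ← h, mat_conjBy, a.mat_conjTranspose, Matrix.mul_assoc, Matrix.trace_mul_comm]

/-- The Laplace transform of a power of the determinant, by the substitution `x ↦ a x a` with
`a` the square root of `ξ`. -/
lemma laplace_rdet {s : ℝ} (hs : -1 < s) {ξ : Herm 𝕜 ι} (hξ : ξ ∈ cone 𝕜 ι) :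
    IntegrableOn (fun x : Herm 𝕜 ι => rdet x.mat ^ s * Real.exp (-inner ℝ ξ x)) (cone 𝕜 ι) ∧
    ∫ x in cone 𝕜 ι, rdet x.mat ^ s * Real.exp (-inner ℝ ξ x) =
      rdet ξ.mat ^ (-(s + dimRatio 𝕜 ι)) *
        ∫ x in cone 𝕜 ι, rdet x.mat ^ s * Real.exp (-RCLike.re x.mat.trace) := by
  obtain ⟨a, ha, haξ⟩ := exists_sqrt hξ
  have hau := isUnit_mat ha
  set T : Herm 𝕜 ι →L[ℝ] Herm 𝕜 ι := LinearMap.toContinuousLinearMap (conjBy a.mat) with hT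
  have hTx : ∀ x, T x = conjBy a.mat x := fun _ => rfl
  have himg : T '' cone 𝕜 ι = cone 𝕜 ι := by
    ext x
    constructor
    · rintro ⟨y, hy, rfl⟩
      exact (mem_cone_conjBy_iff hau y).2 hy
    · intro hx
      refine ⟨conjBy a.inv.mat x, (mem_cone_conjBy_iff (isUnit_mat (inv_mem_cone ha)) x).2 hx, ?_⟩
      rw [hTx, ← LinearMap.comp_apply, ← conjBy_mul, mul_inv_mat ha, conjBy_one, LinearMap.id_apply]
  have hinj : Set.InjOn T (cone 𝕜 ι) := by
    intro x _ y _ hxy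
    have h := congrArg (conjBy a.inv.mat) hxy
    rwa [hTx, hTx, ← LinearMap.comp_apply, ← LinearMap.comp_apply, ← conjBy_mul, inv_mat_mul ha,
      conjBy_one] at h
  have hap := rdet_pos ha
  have hξp := rdet_pos hξ
  have hsq : rdet a.mat ^ 2 = rdet ξ.mat := by rw [← haξ, rdet_mul_self]
  have hdet : |T.det| = rdet ξ.mat ^ dimRatio 𝕜 ι := by
    have : T.det = LinearMap.det (conjBy a.mat) := rfl
    rw [this, det_conjBy ha, ← hsq, abs_of_pos (Real.rpow_pos_of_pos hap _), ← Real.rpow_natCast,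
      ← Real.rpow_mul hap.le]
    norm_num
  have hint : Set.EqOn (fun x => |T.det| • (rdet (T x).mat ^ s *
      Real.exp (-RCLike.re (T x).mat.trace))) (fun x => rdet ξ.mat ^ (s + dimRatio 𝕜 ι) *
        (rdet x.mat ^ s * Real.exp (-inner ℝ ξ x))) (cone 𝕜 ι) := by
    intro x hx
    simp only
    rw [hTx, rdet_conjBy, hsq, inner_mul_self_eq a x haξ, hdet, Real.rpow_add hξp,
      Real.mul_rpow hξp.le (rdet_pos hx).le, smul_eq_mul]
    ring
  have hfd : ∀ x ∈ cone 𝕜 ι, HasFDerivWithinAt T T (cone 𝕜 ι) x :=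
    fun x _ => T.hasFDerivAt.hasFDerivWithinAt
  have h1 := integrableOn_image_iff_integrableOn_abs_det_fderiv_smul volume measurableSet_cone hfd
    hinj (fun x => rdet x.mat ^ s * Real.exp (-RCLike.re x.mat.trace))
  have h2 := integral_image_eq_integral_abs_det_fderiv_smul volume measurableSet_cone hfd
    hinj (fun x => rdet x.mat ^ s * Real.exp (-RCLike.re x.mat.trace))
  have hc : rdet ξ.mat ^ (s + dimRatio 𝕜 ι) ≠ 0 := (Real.rpow_pos_of_pos hξp _).ne'
  rw [himg, integrableOn_congr_fun hint measurableSet_cone] at h1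
  rw [himg, setIntegral_congr_fun measurableSet_cone hint, integral_const_mul] at h2
  refine ⟨?_, ?_⟩
  · have h3 := (h1.1 (integrableOn_gamma hs)).const_mul (rdet ξ.mat ^ (s + dimRatio 𝕜 ι))⁻¹
    simpa [IntegrableOn, inv_mul_cancel_left₀ hc] using h3
  · rw [h2, Real.rpow_neg hξp.le, inv_mul_cancel_left₀ hc]

lemma multiGamma_pos {μ : ℝ} (hμ : -1 < μ - dimRatio 𝕜 ι) : 0 < multiGamma 𝕜 ι μ := by
  rw [multiGamma, setIntegral_pos_iff_support_of_nonneg_ae _ (integrableOn_gamma hμ)]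
  · refine (isOpen_cone 𝕜 ι).measure_pos volume ⟨_, one_mem_cone⟩ |>.trans_le (measure_mono ?_)
    intro x hx
    have := rdet_pos hx
    exact ⟨by rw [Function.mem_support]; positivity, hx⟩
  · filter_upwards [ae_restrict_mem measurableSet_cone] with x hx
    have := rdet_pos hx
    positivity

/-- The Wishart distribution `W_r(μ, ξ)` as a measure. -/
def wishart (μ : ℝ) (ξ : Herm 𝕜 ι) : Measure (Herm 𝕜 ι) :=
  (volume.restrict (cone 𝕜 ι)).withDensity fun x => ENNReal.ofReal (density μ ξ x)

lemma density_eq (μ : ℝ) (ξ x : Herm 𝕜 ι) : density μ ξ x = (rdet ξ.mat ^ μ / multiGamma 𝕜 ι μ) *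
    (rdet x.mat ^ (μ - dimRatio 𝕜 ι) * Real.exp (-inner ℝ ξ x)) := by
  rw [density]; ring

lemma density_pos {μ : ℝ} (hμ : -1 < μ - dimRatio 𝕜 ι) {ξ x : Herm 𝕜 ι} (hξ : ξ ∈ cone 𝕜 ι)
    (hx : x ∈ cone 𝕜 ι) : 0 < density μ ξ x := by
  have h1 := multiGamma_pos hμ
  have h2 := rdet_pos hξ
  have h3 := rdet_pos hx
  rw [density]
  positivity

lemma aemeasurable_density {μ : ℝ} (ξ : Herm 𝕜 ι) :
    AEMeasurable (fun x => density μ ξ x) (volume.restrict (cone 𝕜 ι)) := by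
  refine ContinuousOn.aemeasurable ?_ measurableSet_cone
  simp only [density_eq]
  exact continuousOn_const.mul ((continuousOn_rdet_rpow _).mul
    (Real.continuous_exp.comp ((continuous_const.inner continuous_id).neg)).continuousOn)

lemma wishart_eq {μ : ℝ} (ξ : Herm 𝕜 ι) : wishart μ ξ = (volume.restrict (cone 𝕜 ι)).withDensity
    fun x => ((density μ ξ x).toNNReal : ENNReal) := rfl

lemma integral_wishart {μ : ℝ} (hμ : -1 < μ - dimRatio 𝕜 ι) {ξ : Herm 𝕜 ι} (hξ : ξ ∈ cone 𝕜 ι)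
    (g : Herm 𝕜 ι → ℝ) : ∫ x, g x ∂(wishart μ ξ) = ∫ x in cone 𝕜 ι, g x * density μ ξ x := by
  rw [wishart_eq, integral_withDensity_eq_integral_smul₀ (aemeasurable_density ξ).real_toNNReal]
  refine setIntegral_congr_fun measurableSet_cone fun x hx => ?_
  simp only [NNReal.smul_def, Real.coe_toNNReal _ (density_pos hμ hξ hx).le, smul_eq_mul]
  ring

lemma integrable_wishart_iff {μ : ℝ} (hμ : -1 < μ - dimRatio 𝕜 ι) {ξ : Herm 𝕜 ι}
    (hξ : ξ ∈ cone 𝕜 ι) (g : Herm 𝕜 ι → ℝ) : Integrable g (wishart μ ξ) ↔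
      IntegrableOn (fun x => g x * density μ ξ x) (cone 𝕜 ι) := by
  rw [wishart_eq, integrable_withDensity_iff_integrable_smul₀
    (aemeasurable_density ξ).real_toNNReal]
  refine integrableOn_congr_fun (fun x hx => ?_) measurableSet_cone
  simp only [NNReal.smul_def, Real.coe_toNNReal _ (density_pos hμ hξ hx).le, smul_eq_mul]
  ring

/-- Exponential tilting changes the parameter of a Wishart density. -/
lemma exp_mul_density {μ : ℝ} (ξ u x : Herm 𝕜 ι) (t : ℝ) :
    Real.exp (t * -inner ℝ u x) * density μ ξ x = (rdet ξ.mat ^ μ / multiGamma 𝕜 ι μ) *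
      (rdet x.mat ^ (μ - dimRatio 𝕜 ι) * Real.exp (-inner ℝ (ξ + t • u) x)) := by
  rw [density_eq, inner_add_left, real_inner_smul_left, neg_add, Real.exp_add, mul_neg]
  ring

lemma eventually_line_mem_cone {ξ : Herm 𝕜 ι} (hξ : ξ ∈ cone 𝕜 ι) (u : Herm 𝕜 ι) :
    ∀ᶠ t : ℝ in nhds 0, ξ + t • u ∈ cone 𝕜 ι := by
  have hc : Continuous fun t : ℝ => ξ + t • u := by fun_prop
  exact hc.continuousAt.eventually ((isOpen_cone 𝕜 ι).mem_nhds (by simpa using hξ))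

lemma mgf_wishart {μ : ℝ} (hμ : -1 < μ - dimRatio 𝕜 ι) {ξ u : Herm 𝕜 ι} (hξ : ξ ∈ cone 𝕜 ι)
    {t : ℝ} (ht : ξ + t • u ∈ cone 𝕜 ι) :
    t ∈ integrableExpSet (fun x => -inner ℝ u x) (wishart μ ξ) ∧
    mgf (fun x => -inner ℝ u x) (wishart μ ξ) t = rdet ξ.mat ^ μ * rdet (ξ + t • u).mat ^ (-μ) := by
  obtain ⟨h1, h2⟩ := laplace_rdet hμ ht
  constructor
  · rw [integrableExpSet, Set.mem_ofPred_eq, integrable_wishart_iff hμ hξ]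
    simp only [exp_mul_density]
    exact h1.const_mul _
  · rw [mgf, integral_wishart hμ hξ]
    simp only [exp_mul_density]
    rw [integral_const_mul, h2, ← multiGamma, sub_add_cancel]
    field_simp [(multiGamma_pos hμ).ne']

lemma zero_mem_interior_integrableExpSet {μ : ℝ} (hμ : -1 < μ - dimRatio 𝕜 ι) {ξ : Herm 𝕜 ι}
    (hξ : ξ ∈ cone 𝕜 ι) (u : Herm 𝕜 ι) :
    0 ∈ interior (integrableExpSet (fun x => -inner ℝ u x) (wishart μ ξ)) := by
  rw [mem_interior_iff_mem_nhds]
  filter_upwards [eventually_line_mem_cone hξ u] with t ht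
  exact (mgf_wishart hμ hξ ht).1

lemma isProbabilityMeasure_wishart {μ : ℝ} (hμ : -1 < μ - dimRatio 𝕜 ι) {ξ : Herm 𝕜 ι}
    (hξ : ξ ∈ cone 𝕜 ι) : IsProbabilityMeasure (wishart μ ξ) := by
  have h0 : ξ + (0 : ℝ) • (0 : Herm 𝕜 ι) ∈ cone 𝕜 ι := by simpa using hξ
  have h := (mgf_wishart hμ hξ h0).2
  rw [zero_smul, add_zero, Real.rpow_neg (rdet_pos hξ).le,
    mul_inv_cancel₀ (Real.rpow_pos_of_pos (rdet_pos hξ) _).ne'] at h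
  simp only [mgf, inner_zero_left, neg_zero, mul_zero, Real.exp_zero, integral_const, smul_eq_mul,
    mul_one] at h
  rw [measureReal_def] at h
  exact ⟨(ENNReal.toReal_eq_one_iff _).1 h⟩

lemma hasDerivAt_inner_inv_line {ξ : Herm 𝕜 ι} (u : Herm 𝕜 ι) {t : ℝ} (ht : ξ + t • u ∈ cone 𝕜 ι) :
    HasDerivAt (fun t : ℝ => inner ℝ (ξ + t • u).inv u)
      (-inner ℝ (conjBy (ξ + t • u).inv.mat u) u) t := by
  have hl : HasDerivAt (fun t : ℝ => ξ + t • u) u t := by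
    simpa using ((hasDerivAt_id t).smul_const u).const_add ξ
  have h1 := ((hasFDerivAt_inv ht).comp_hasDerivAt t hl).inner ℝ (hasDerivAt_const t u)
  simpa using h1

lemma cgf_wishart {μ : ℝ} (hμ : -1 < μ - dimRatio 𝕜 ι) {ξ u : Herm 𝕜 ι} (hξ : ξ ∈ cone 𝕜 ι)
    {t : ℝ} (ht : ξ + t • u ∈ cone 𝕜 ι) : cgf (fun x => -inner ℝ u x) (wishart μ ξ) t =
      μ * Real.log (rdet ξ.mat) - μ * Real.log (rdet (ξ + t • u).mat) := by
  have h1 := rdet_pos hξ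
  have h2 := rdet_pos ht
  rw [cgf, (mgf_wishart hμ hξ ht).2, Real.log_mul (by positivity) (by positivity),
    Real.log_rpow h1, Real.log_rpow h2]
  ring

lemma deriv_cgf_wishart {μ : ℝ} (hμ : -1 < μ - dimRatio 𝕜 ι) {ξ u : Herm 𝕜 ι} (hξ : ξ ∈ cone 𝕜 ι)
    {t : ℝ} (ht : ∀ᶠ t' in nhds t, ξ + t' • u ∈ cone 𝕜 ι) :
    deriv (cgf (fun x => -inner ℝ u x) (wishart μ ξ)) t = -μ * inner ℝ (ξ + t • u).inv u := by
  have hl : HasDerivAt (fun t : ℝ => ξ + t • u) u t := by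
    simpa using ((hasDerivAt_id t).smul_const u).const_add ξ
  have h1 := (((hasFDerivAt_log_rdet ht.self_of_nhds).comp_hasDerivAt t hl).const_mul μ).const_sub
    (μ * Real.log (rdet ξ.mat))
  have h2 : cgf (fun x => -inner ℝ u x) (wishart μ ξ) =ᶠ[nhds t] fun t =>
      μ * Real.log (rdet ξ.mat) - μ * Real.log (rdet (ξ + t • u).mat) :=
    ht.mono fun t' ht' => cgf_wishart hμ hξ ht'
  rw [h2.deriv_eq]
  refine h1.deriv.trans ?_
  rw [innerSL_apply_apply, neg_mul]

lemma integral_neg_inner_wishart {μ : ℝ} (hμ : -1 < μ - dimRatio 𝕜 ι) {ξ : Herm 𝕜 ι}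
    (hξ : ξ ∈ cone 𝕜 ι) (u : Herm 𝕜 ι) :
    ∫ x, -inner ℝ u x ∂(wishart μ ξ) = -μ * inner ℝ ξ.inv u := by
  have := isProbabilityMeasure_wishart hμ hξ
  have h := deriv_cgf_zero (zero_mem_interior_integrableExpSet hμ hξ u)
  rw [deriv_cgf_wishart hμ hξ (eventually_line_mem_cone hξ u)] at h
  simpa using h.symm

lemma variance_wishart {μ : ℝ} (hμ : -1 < μ - dimRatio 𝕜 ι) {ξ : Herm 𝕜 ι}
    (hξ : ξ ∈ cone 𝕜 ι) (u : Herm 𝕜 ι) :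
    Var[fun x => -inner ℝ u x; wishart μ ξ] = μ * inner ℝ (conjBy ξ.inv.mat u) u := by
  have := isProbabilityMeasure_wishart hμ hξ
  have h := variance_tilted_mul (zero_mem_interior_integrableExpSet hμ hξ u)
  have h0 : (wishart μ ξ).tilted (fun x => 0 * -inner ℝ u x) = wishart μ ξ := by
    simp
  have hd : deriv (cgf (fun x => -inner ℝ u x) (wishart μ ξ)) =ᶠ[nhds 0]
      fun t => -μ * inner ℝ (ξ + t • u).inv u :=
    (eventually_line_mem_cone hξ u).eventually_nhds.mono fun t ht => deriv_cgf_wishart hμ hξ ht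
  have h1 := (hasDerivAt_inner_inv_line (ξ := ξ) u (t := 0) (by simpa using hξ)).const_mul (-μ)
  rw [h0, iteratedDeriv_succ, iteratedDeriv_one, hd.deriv_eq, h1.deriv] at h
  simpa using h

lemma memLp_inner_wishart {μ : ℝ} (hμ : -1 < μ - dimRatio 𝕜 ι) {ξ : Herm 𝕜 ι}
    (hξ : ξ ∈ cone 𝕜 ι) (u : Herm 𝕜 ι) : MemLp (fun x => -inner ℝ u x) 2 (wishart μ ξ) :=
  memLp_of_mem_interior_integrableExpSet (zero_mem_interior_integrableExpSet hμ hξ u) 2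

lemma inner_conjBy (a : Matrix ι ι 𝕜) (x y : Herm 𝕜 ι) :
    inner ℝ (conjBy a x) y = inner ℝ x (conjBy a.conjTranspose y) := by
  rw [Herm.inner_eq, Herm.inner_eq, mat_conjBy, mat_conjBy, Matrix.conjTranspose_conjTranspose]
  simp only [Matrix.mul_assoc]
  rw [Matrix.trace_mul_comm a]
  simp only [Matrix.mul_assoc]

lemma inner_conjBy_mat (a x y : Herm 𝕜 ι) :
    inner ℝ (conjBy a.mat x) y = inner ℝ x (conjBy a.mat y) := by
  rw [inner_conjBy, a.mat_conjTranspose]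

lemma covariance_wishart {μ : ℝ} (hμ : -1 < μ - dimRatio 𝕜 ι) {ξ : Herm 𝕜 ι}
    (hξ : ξ ∈ cone 𝕜 ι) (u v : Herm 𝕜 ι) :
    cov[fun x => -inner ℝ u x, fun x => -inner ℝ v x; wishart μ ξ] =
      μ * inner ℝ (conjBy ξ.inv.mat u) v := by
  have := isProbabilityMeasure_wishart hμ hξ
  have h := variance_add (memLp_inner_wishart hμ hξ u) (memLp_inner_wishart hμ hξ v)
  have hadd : ((fun x => -inner ℝ u x) + fun x => -inner ℝ v x) =
      fun x : Herm 𝕜 ι => -inner ℝ (u + v) x := by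
    ext x; simp [inner_add_left]; ring
  rw [hadd, variance_wishart hμ hξ, variance_wishart hμ hξ, variance_wishart hμ hξ, map_add,
    inner_add_left, inner_add_right, inner_add_right, inner_conjBy_mat ξ.inv v u,
    real_inner_comm (conjBy ξ.inv.mat u) v] at h
  linarith

lemma fderiv_log_density {μ : ℝ} (hμ : -1 < μ - dimRatio 𝕜 ι) {ξ x : Herm 𝕜 ι}
    (hξ : ξ ∈ cone 𝕜 ι) (hx : x ∈ cone 𝕜 ι) (u : Herm 𝕜 ι) :
    fderiv ℝ (fun η => Real.log (density μ η x)) ξ u = μ * inner ℝ ξ.inv u - inner ℝ u x := by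
  have hG := multiGamma_pos hμ
  have h2 := rdet_pos hx
  have he : (fun η => Real.log (density μ η x)) =ᶠ[nhds ξ] fun η =>
      Real.log (rdet x.mat ^ (μ - dimRatio 𝕜 ι) / multiGamma 𝕜 ι μ) +
        μ * Real.log (rdet η.mat) - inner ℝ x η := by
    filter_upwards [(isOpen_cone 𝕜 ι).mem_nhds hξ] with η hη
    have h3 := rdet_pos hη
    rw [density, Real.log_mul (by positivity) (by positivity), Real.log_exp,
      Real.log_mul (by positivity) (by positivity), Real.log_rpow h3, real_inner_comm]
    ring
  have h := (((hasFDerivAt_log_rdet hξ).const_mul μ).const_add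
    (Real.log (rdet x.mat ^ (μ - dimRatio 𝕜 ι) / multiGamma 𝕜 ι μ))).sub
    (innerSL ℝ x).hasFDerivAt
  have h' := he.fderiv_eq.trans (HasFDerivAt.fderiv h)
  rw [h']
  simp [real_inner_comm]

/-- The Fisher metric per unit of observation is `⟨ξ⁻¹ u ξ⁻¹ | v⟩`: the score in the direction `u` is
the centred variable `-⟨u | x⟩`. -/
lemma unitFisher_eq {μ : ℝ} (hμ : -1 < μ - dimRatio 𝕜 ι) (hμ0 : μ ≠ 0) {ξ : Herm 𝕜 ι}
    (hξ : ξ ∈ cone 𝕜 ι) (u v : Herm 𝕜 ι) :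
    unitFisher μ ξ u v = inner ℝ (conjBy ξ.inv.mat u) v := by
  have h : fisher μ ξ u v = cov[fun x => -inner ℝ u x, fun x => -inner ℝ v x; wishart μ ξ] := by
    rw [covariance, integral_wishart hμ hξ, fisher]
    refine setIntegral_congr_fun measurableSet_cone fun x hx => ?_
    simp only [fderiv_log_density hμ hξ hx, integral_neg_inner_wishart hμ hξ]
    ring
  rw [unitFisher, h, covariance_wishart hμ hξ, inv_mul_cancel_left₀ hμ0]

end

end

/-! ### The Laplace–Beltrami operator of the invariant metric -/

section

variable {𝕜 : Type*} {ι : Type u} [RCLike 𝕜] [Fintype ι] [DecidableEq ι]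

lemma conjBy_inv_conjBy {ξ : Herm 𝕜 ι} (hξ : ξ ∈ cone 𝕜 ι) (x : Herm 𝕜 ι) :
    conjBy ξ.inv.mat (conjBy ξ.mat x) = x := by
  rw [← LinearMap.comp_apply, ← conjBy_mul, inv_mat_mul hξ, conjBy_one, LinearMap.id_apply]

/-- `g` is the invariant metric `⟨ξ⁻¹ u ξ⁻¹ | v⟩` of the symmetric cone. -/
def IsConeMetric (g : Herm 𝕜 ι → Herm 𝕜 ι → Herm 𝕜 ι → ℝ) : Prop :=
  ∀ ξ ∈ cone 𝕜 ι, ∀ u v, g ξ u v = inner ℝ (conjBy ξ.inv.mat u) v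

lemma inner_conjBy_inv_self_pos {ξ : Herm 𝕜 ι} (hξ : ξ ∈ cone 𝕜 ι) {u : Herm 𝕜 ι} (hu : u ≠ 0) :
    0 < inner ℝ (conjBy ξ.inv.mat u) u := by
  obtain ⟨a, ha, haξ⟩ := exists_sqrt (inv_mem_cone hξ)
  rw [← haξ, conjBy_mul, LinearMap.comp_apply, inner_conjBy_mat]
  refine real_inner_self_pos.2 fun h => hu ?_
  rw [← conjBy_inv_conjBy ha u, h, map_zero]

variable {β : Type*} [Fintype β] {g : Herm 𝕜 ι → Herm 𝕜 ι → Herm 𝕜 ι → ℝ}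

lemma IsConeMetric.posDef_gram (hg : IsConeMetric g) (b : Module.Basis β ℝ (Herm 𝕜 ι))
    {ξ : Herm 𝕜 ι} (hξ : ξ ∈ cone 𝕜 ι) : (gram g b ξ).PosDef := by
  refine Matrix.PosDef.of_dotProduct_mulVec_pos ?_ fun x hx => ?_
  · ext i j
    simp only [gram, Matrix.conjTranspose_apply, Matrix.of_apply, star_trivial, hg ξ hξ]
    rw [inner_conjBy_mat, real_inner_comm]
  · have h : star x ⬝ᵥ (gram g b ξ).mulVec x =
        inner ℝ (conjBy ξ.inv.mat (∑ i, x i • b i)) (∑ i, x i • b i) := by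
      simp only [dotProduct, Matrix.mulVec, gram, Matrix.of_apply, hg ξ hξ, map_sum, map_smul,
        sum_inner, inner_sum, real_inner_smul_left, real_inner_smul_right, Pi.star_apply,
        star_trivial, Finset.mul_sum]
      exact Finset.sum_congr rfl fun i _ => Finset.sum_congr rfl fun j _ => by
        rw [inner_conjBy_mat ξ.inv (b j), real_inner_comm]
        ring
    rw [h]
    refine inner_conjBy_inv_self_pos hξ fun h0 => hx ?_
    funext i
    exact Fintype.linearIndependent_iff.1 b.linearIndependent x h0 i

lemma IsConeMetric.det_gram [DecidableEq β] (hg : IsConeMetric g)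
    (b : Module.Basis β ℝ (Herm 𝕜 ι)) {ξ : Herm 𝕜 ι} (hξ : ξ ∈ cone 𝕜 ι) :
    (gram g b ξ).det = (Matrix.of fun i j => inner ℝ (b i) (b j)).det *
      (rdet ξ.mat ^ (-dimRatio 𝕜 ι)) ^ 2 := by
  have h : gram g b ξ = (Matrix.of fun i j => inner ℝ (b i) (b j)) *
      LinearMap.toMatrix b b (conjBy ξ.inv.mat) := by
    ext i j
    rw [gram, Matrix.of_apply, hg ξ hξ, inner_conjBy_mat]
    conv_lhs => rw [← b.sum_repr (conjBy ξ.inv.mat (b j))]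
    simp only [Matrix.mul_apply, Matrix.of_apply, LinearMap.toMatrix_apply, inner_sum,
      real_inner_smul_right, mul_comm]
  rw [h, Matrix.det_mul, LinearMap.det_toMatrix, det_conjBy (inv_mem_cone hξ), rdet_inv hξ,
    Real.inv_rpow (rdet_pos hξ).le, ← Real.rpow_neg (rdet_pos hξ).le, ← Real.rpow_mul_natCast
    (rdet_pos hξ).le]
  congr 2
  push_cast
  ring

lemma IsConeMetric.sqrt_det_gram [DecidableEq β] (hg : IsConeMetric g)
    (b : Module.Basis β ℝ (Herm 𝕜 ι)) {ξ : Herm 𝕜 ι} (hξ : ξ ∈ cone 𝕜 ι) :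
    √(gram g b ξ).det = √(Matrix.of fun i j => inner ℝ (b i) (b j)).det *
      rdet ξ.mat ^ (-dimRatio 𝕜 ι) := by
  rw [hg.det_gram b hξ, Real.sqrt_mul' _ (sq_nonneg _),
    Real.sqrt_sq (Real.rpow_pos_of_pos (rdet_pos hξ) _).le]

/-- The gradient of a function for the cone metric: `ξ F ξ`, if `F` is its Euclidean gradient. -/
lemma IsConeMetric.sum_inv_gram [DecidableEq β] (hg : IsConeMetric g)
    (b : Module.Basis β ℝ (Herm 𝕜 ι)) {ξ : Herm 𝕜 ι} (hξ : ξ ∈ cone 𝕜 ι) (F : Herm 𝕜 ι) (i : β) :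
    ∑ j, (gram g b ξ)⁻¹ i j * inner ℝ F (b j) = b.coord i (conjBy ξ.mat F) := by
  set v : β → ℝ := fun j => b.coord j (conjBy ξ.mat F) with hv
  have h : (gram g b ξ).mulVec v = fun j => inner ℝ F (b j) := by
    funext i
    have h1 : (gram g b ξ).mulVec v i =
        inner ℝ (conjBy ξ.inv.mat (b i)) (∑ j, b.repr (conjBy ξ.mat F) j • b j) := by
      simp only [Matrix.mulVec, dotProduct, gram, Matrix.of_apply, hg ξ hξ, inner_sum,
        real_inner_smul_right, hv, Module.Basis.coord_apply, mul_comm]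
    rw [h1, b.sum_repr, inner_conjBy_mat, conjBy_inv_conjBy hξ, real_inner_comm]
  have h2 : (gram g b ξ)⁻¹.mulVec ((gram g b ξ).mulVec v) = v := by
    rw [Matrix.mulVec_mulVec, Matrix.nonsing_inv_mul _
      ((Matrix.isUnit_iff_isUnit_det _).1 (hg.posDef_gram b hξ).isUnit), Matrix.one_mulVec]
  rw [h] at h2
  exact congrFun h2 i

lemma sum_coord_eq_trace (b : Module.Basis β ℝ (Herm 𝕜 ι)) (f : Herm 𝕜 ι →ₗ[ℝ] Herm 𝕜 ι) :
    ∑ i, b.coord i (f (b i)) = LinearMap.trace ℝ _ f := by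
  classical
  rw [LinearMap.trace_eq_matrix_trace ℝ b]
  simp [Matrix.trace, LinearMap.toMatrix_apply]

lemma sum_inner_mul_coord (b : Module.Basis β ℝ (Herm 𝕜 ι)) (x y : Herm 𝕜 ι) :
    ∑ i, inner ℝ x (b i) * b.coord i y = inner ℝ x y := by
  conv_rhs => rw [← b.sum_repr y, inner_sum]
  simp [real_inner_smul_right, mul_comm]

/-- The Laplace–Beltrami operator of the cone metric in divergence form. -/
lemma IsConeMetric.laplaceBeltrami_eq [DecidableEq β] (hg : IsConeMetric g)
    (b : Module.Basis β ℝ (Herm 𝕜 ι)) {f : Herm 𝕜 ι → ℝ} {F : Herm 𝕜 ι → Herm 𝕜 ι}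
    (hf : ∀ y ∈ cone 𝕜 ι, HasFDerivAt f (innerSL ℝ (F y)) y) {ξ : Herm 𝕜 ι} (hξ : ξ ∈ cone 𝕜 ι)
    {V' : Herm 𝕜 ι →L[ℝ] Herm 𝕜 ι} (hV : HasFDerivAt (fun y => conjBy y.mat (F y)) V' ξ) :
    laplaceBeltrami g b f ξ = LinearMap.trace ℝ _ (V' : Herm 𝕜 ι →ₗ[ℝ] Herm 𝕜 ι) -
      dimRatio 𝕜 ι * inner ℝ ξ.inv (conjBy ξ.mat (F ξ)) := by
  set ν := dimRatio 𝕜 ι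
  set c := √(Matrix.of fun i j => inner ℝ (b i) (b j)).det with hc
  set ρ : Herm 𝕜 ι → ℝ := fun y => Real.exp (-ν * Real.log (rdet y.mat)) with hρ
  have hρ' : ∀ y ∈ cone 𝕜 ι, √(gram g b y).det = c * ρ y := fun y hy => by
    rw [hg.sqrt_det_gram b hy, Real.rpow_def_of_pos (rdet_pos hy), hρ, mul_comm (Real.log _)]
  have hdρ : HasFDerivAt ρ ((-ν * ρ ξ) • innerSL ℝ ξ.inv) ξ := by
    refine (((hasFDerivAt_log_rdet hξ).const_mul (-ν)).exp).congr_fderiv ?_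
    rw [smul_smul, mul_comm]
  have hsum : ∀ i, fderiv ℝ (fun y => √(gram g b y).det *
      ∑ j, (gram g b y)⁻¹ i j * fderiv ℝ f y (b j)) ξ (b i) =
      c * ρ ξ * (b.coord i (V' (b i)) - ν * (inner ℝ ξ.inv (b i) *
        b.coord i (conjBy ξ.mat (F ξ)))) := by
    intro i
    have he : (fun y => √(gram g b y).det * ∑ j, (gram g b y)⁻¹ i j * fderiv ℝ f y (b j))
        =ᶠ[nhds ξ] fun y => (c * ρ y) * b.coord i (conjBy y.mat (F y)) := by
      filter_upwards [(isOpen_cone 𝕜 ι).mem_nhds hξ] with y hy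
      simp only [hρ' y hy, (hf y hy).fderiv, innerSL_apply_apply]
      rw [hg.sum_inv_gram b hy]
    have hd := (hdρ.const_mul c).mul
      ((LinearMap.toContinuousLinearMap (b.coord i)).hasFDerivAt.comp ξ hV)
    rw [he.fderiv_eq]
    have hd' := congrArg (fun L => L (b i)) (HasFDerivAt.fderiv hd)
    refine hd'.trans ?_
    simp
    ring
  rw [laplaceBeltrami]
  have htr := sum_coord_eq_trace b (V' : Herm 𝕜 ι →ₗ[ℝ] Herm 𝕜 ι)
  simp only [ContinuousLinearMap.coe_coe] at htr
  simp only [hsum]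
  rw [← Finset.mul_sum, hρ' ξ hξ, Finset.sum_sub_distrib, ← Finset.mul_sum, sum_inner_mul_coord,
    htr, inv_mul_cancel_left₀]
  rw [← hρ' ξ hξ]
  exact (Real.sqrt_pos.2 (hg.posDef_gram b hξ).det_pos).ne'

/-- The Laplace–Beltrami operator applied to an exponential `e^φ`; `Φ` is the Euclidean gradient of
`φ` and `W'` the derivative of the Riemannian gradient `ξ Φ ξ`. -/
lemma IsConeMetric.laplaceBeltrami_exp [DecidableEq β] (hg : IsConeMetric g)
    (b : Module.Basis β ℝ (Herm 𝕜 ι)) {f φ : Herm 𝕜 ι → ℝ} {Φ : Herm 𝕜 ι → Herm 𝕜 ι}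
    (hf : ∀ y ∈ cone 𝕜 ι, f y = Real.exp (φ y))
    (hφ : ∀ y ∈ cone 𝕜 ι, HasFDerivAt φ (innerSL ℝ (Φ y)) y) {ξ : Herm 𝕜 ι} (hξ : ξ ∈ cone 𝕜 ι)
    {W' : Herm 𝕜 ι →L[ℝ] Herm 𝕜 ι} (hW : HasFDerivAt (fun y => conjBy y.mat (Φ y)) W' ξ) :
    laplaceBeltrami g b f ξ = (LinearMap.trace ℝ _ (W' : Herm 𝕜 ι →ₗ[ℝ] Herm 𝕜 ι) +
      inner ℝ (Φ ξ) (conjBy ξ.mat (Φ ξ)) -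
      dimRatio 𝕜 ι * inner ℝ ξ.inv (conjBy ξ.mat (Φ ξ))) * f ξ := by
  have hfd : ∀ y ∈ cone 𝕜 ι, HasFDerivAt f (innerSL ℝ (f y • Φ y)) y := by
    intro y hy
    have he : f =ᶠ[nhds y] fun y => Real.exp (φ y) := by
      filter_upwards [(isOpen_cone 𝕜 ι).mem_nhds hy] with z hz using hf z hz
    refine ((hφ y hy).exp.congr_of_eventuallyEq he).congr_fderiv ?_
    rw [hf y hy, map_smul]
  have hV : HasFDerivAt (fun y => conjBy y.mat (f y • Φ y))
      (f ξ • W' + (innerSL ℝ (f ξ • Φ ξ)).smulRight (conjBy ξ.mat (Φ ξ))) ξ := by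
    exact ((hfd ξ hξ).smul hW).congr_of_eventuallyEq (.of_forall fun y => map_smul _ _ _)
  rw [hg.laplaceBeltrami_eq b hfd hξ hV, ContinuousLinearMap.toLinearMap_add]
  simp [real_inner_smul_right]
  ring

end

/-! ### Principal minors -/

section

variable {𝕜 : Type*} {ι : Type u} [RCLike 𝕜] [Fintype ι] [DecidableEq ι]

variable (𝕜) in
/-- The diagonal projection onto the coordinates in `S`. -/
def proj (S : Finset ι) : Herm 𝕜 ι :=
  Herm.of (Matrix.diagonal fun i => ((if i ∈ S then 1 else 0 : ℝ) : 𝕜))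
    (conjTranspose_diagonal_ofReal _)

lemma mat_proj (S : Finset ι) :
    (proj 𝕜 S).mat = Matrix.diagonal fun i => ((if i ∈ S then 1 else 0 : ℝ) : 𝕜) := rfl

lemma proj_mul_proj {S T : Finset ι} (h : S ⊆ T) :
    (proj 𝕜 T).mat * (proj 𝕜 S).mat = (proj 𝕜 S).mat := by
  rw [mat_proj, mat_proj, Matrix.diagonal_mul_diagonal]
  congr 1
  funext i
  by_cases hi : i ∈ S
  · simp [hi, h hi]
  · simp [hi]

lemma proj_compl (S : Finset ι) : (proj 𝕜 Sᶜ).mat = 1 - (proj 𝕜 S).mat := by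
  rw [mat_proj, mat_proj, ← Matrix.diagonal_one, Matrix.diagonal_sub]
  congr 1
  funext i
  by_cases hi : i ∈ S <;> simp [hi]

lemma trace_proj (S : Finset ι) : RCLike.re (proj 𝕜 S).mat.trace = S.card := by
  rw [mat_proj, Matrix.trace_diagonal, ← RCLike.ofReal_sum, RCLike.ofReal_re]
  simp

lemma trace_conjBy_proj (S : Finset ι) :
    LinearMap.trace ℝ _ (conjBy (proj 𝕜 S).mat) =
      (1 - peirceInv 𝕜 / 2) * S.card + peirceInv 𝕜 / 2 * (S.card : ℝ) ^ 2 := by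
  rw [mat_proj, trace_conjBy_diagonal]
  simp

/-- The principal submatrix of `ξ` with rows and columns in `S`, extended by the identity to a
matrix of full size. Its determinant is the principal minor. -/
def corner (S : Finset ι) (ξ : Herm 𝕜 ι) : Herm 𝕜 ι := conjBy (proj 𝕜 S).mat ξ + proj 𝕜 Sᶜ

/-- The inverse of the principal submatrix with rows and columns in `S`, extended by zero to a
matrix of full size. -/
def padInv (S : Finset ι) (ξ : Herm 𝕜 ι) : Herm 𝕜 ι := conjBy (proj 𝕜 S).mat (corner S ξ).inv

lemma mat_corner (S : Finset ι) (ξ : Herm 𝕜 ι) : (corner S ξ).mat =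
    (proj 𝕜 S).mat * ξ.mat * (proj 𝕜 S).mat + (1 - (proj 𝕜 S).mat) := by
  rw [corner, Herm.mat_add, mat_conjBy, (proj 𝕜 S).mat_conjTranspose, proj_compl]

lemma corner_mem_cone (S : Finset ι) {ξ : Herm 𝕜 ι} (hξ : ξ ∈ cone 𝕜 ι) :
    corner S ξ ∈ cone 𝕜 ι := by
  -- Subtract a small multiple `ε` of the identity from `ξ` and add it back as a diagonal matrix.
  have h1 := eventually_line_mem_cone hξ (-Herm.of 1 Matrix.conjTranspose_one)
  obtain ⟨ε, hε, hε0⟩ := ((h1.filter_mono nhdsWithin_le_nhds).and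
    (self_mem_nhdsWithin (s := Set.Ioi (0 : ℝ)))).exists
  have h2 : Matrix.PosSemidef (conjBy (proj 𝕜 S).mat
      (ξ + ε • -Herm.of 1 Matrix.conjTranspose_one)).mat :=
    (Matrix.PosDef.posSemidef hε).mul_mul_conjTranspose_same (proj 𝕜 S).mat
  have h3 : Matrix.PosDef
      (Matrix.diagonal fun i => ((if i ∈ S then ε else 1 : ℝ) : 𝕜)) :=
    Matrix.PosDef.diagonal fun i => by
      have h0 : (0 : ℝ) < ε := hε0
      split_ifs <;> simp [h0]
  have h4 := Matrix.PosDef.posSemidef_add h2 h3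
  have h5 : (corner S ξ).mat = (conjBy (proj 𝕜 S).mat
      (ξ + ε • -Herm.of 1 Matrix.conjTranspose_one)).mat +
      Matrix.diagonal fun i => ((if i ∈ S then ε else 1 : ℝ) : 𝕜) := by
    have h6 : (Matrix.diagonal fun i => ((if i ∈ S then ε else 1 : ℝ) : 𝕜)) =
        ε • (proj 𝕜 S).mat + (1 - (proj 𝕜 S).mat) := by
      rw [← proj_compl, mat_proj, mat_proj, ← Matrix.diagonal_smul, Matrix.diagonal_add]
      congr 1
      funext i
      by_cases hi : i ∈ S <;> simp [hi, RCLike.real_smul_eq_coe_mul]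
    rw [h6, mat_corner, mat_conjBy, (proj 𝕜 S).mat_conjTranspose]
    simp [mul_add, add_mul, proj_mul_proj (𝕜 := 𝕜) (subset_refl S)]
  change Matrix.PosDef _
  rwa [h5]

/-- The padded inverse satisfies `A ξ P = P`, as `P` commutes with `P ξ P + 1 - P`. -/
lemma padInv_mul_mul_proj (S : Finset ι) {ξ : Herm 𝕜 ι} (hξ : ξ ∈ cone 𝕜 ι) :
    (padInv S ξ).mat * ξ.mat * (proj 𝕜 S).mat = (proj 𝕜 S).mat := by
  set P := (proj 𝕜 S).mat
  have hP : P * P = P := proj_mul_proj (subset_refl S)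
  set Y := (corner S ξ).mat with hY
  set R := (corner S ξ).inv.mat
  have hRY : R * Y = 1 := inv_mat_mul (corner_mem_cone S hξ)
  have hYR : Y * R = 1 := mul_inv_mat (corner_mem_cone S hξ)
  have hYP : Y * P = P * ξ.mat * P := by
    rw [hY, mat_corner]
    simp only [add_mul, sub_mul, one_mul, Matrix.mul_assoc]
    rw [show (proj 𝕜 S).mat = P from rfl, hP, sub_self, add_zero]
  have hPY : P * Y = P * ξ.mat * P := by
    rw [hY, mat_corner]
    simp only [mul_add, mul_sub, mul_one, ← Matrix.mul_assoc]
    rw [show (proj 𝕜 S).mat = P from rfl, hP, sub_self, add_zero]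
  have hRP : R * P = P * R := by
    calc R * P = R * P * (Y * R) := by rw [hYR, mul_one]
      _ = R * (P * Y) * R := by simp only [Matrix.mul_assoc]
      _ = (R * Y) * P * R := by rw [hPY, ← hYP]; simp only [Matrix.mul_assoc]
      _ = P * R := by rw [hRY, one_mul]
  have hA : (padInv S ξ).mat = R * P := by
    rw [padInv, mat_conjBy, (proj 𝕜 S).mat_conjTranspose]
    change P * R * P = R * P
    rw [← hRP, Matrix.mul_assoc, hP]
  rw [hA]
  calc R * P * ξ.mat * P = R * (P * ξ.mat * P) := by simp only [Matrix.mul_assoc]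
    _ = P := by rw [← hYP, ← Matrix.mul_assoc, hRY, one_mul]

lemma proj_mul_padInv {S T : Finset ι} (h : S ⊆ T) (ξ : Herm 𝕜 ι) :
    (proj 𝕜 T).mat * (padInv S ξ).mat = (padInv S ξ).mat := by
  rw [padInv, mat_conjBy]
  simp only [← Matrix.mul_assoc, proj_mul_proj h]

lemma padInv_mul_proj (S : Finset ι) (ξ : Herm 𝕜 ι) :
    (padInv S ξ).mat * (proj 𝕜 S).mat = (padInv S ξ).mat := by
  have h := congrArg Matrix.conjTranspose (proj_mul_padInv (subset_refl S) ξ)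
  rwa [Matrix.conjTranspose_mul, (proj 𝕜 S).mat_conjTranspose, (padInv S ξ).mat_conjTranspose] at h

lemma proj_mul_mul_padInv (S : Finset ι) {ξ : Herm 𝕜 ι} (hξ : ξ ∈ cone 𝕜 ι) :
    (proj 𝕜 S).mat * ξ.mat * (padInv S ξ).mat = (proj 𝕜 S).mat := by
  have h := congrArg Matrix.conjTranspose (padInv_mul_mul_proj S hξ)
  rwa [Matrix.conjTranspose_mul, Matrix.conjTranspose_mul, (proj 𝕜 S).mat_conjTranspose,
    (padInv S ξ).mat_conjTranspose, ξ.mat_conjTranspose, ← Matrix.mul_assoc] at h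

lemma padInv_mul_mul_padInv {S T : Finset ι} (h : S ⊆ T) {ξ : Herm 𝕜 ι} (hξ : ξ ∈ cone 𝕜 ι) :
    (padInv T ξ).mat * ξ.mat * (padInv S ξ).mat = (padInv S ξ).mat := by
  rw [← proj_mul_padInv h, ← Matrix.mul_assoc, padInv_mul_mul_proj T hξ]

lemma trace_padInv_mul (S : Finset ι) {ξ : Herm 𝕜 ι} (hξ : ξ ∈ cone 𝕜 ι) :
    RCLike.re ((padInv S ξ).mat * ξ.mat).trace = S.card := by
  rw [← proj_mul_padInv (subset_refl S) ξ, Matrix.mul_assoc, Matrix.trace_mul_comm,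
    padInv_mul_mul_proj S hξ, trace_proj]

lemma inner_inv_conjBy_padInv (S : Finset ι) {ξ : Herm 𝕜 ι} (hξ : ξ ∈ cone 𝕜 ι) :
    inner ℝ ξ.inv (conjBy ξ.mat (padInv S ξ)) = S.card := by
  rw [Herm.inner_eq, mat_conjBy, ← Matrix.mul_assoc, ← Matrix.mul_assoc, inv_mat_mul hξ, one_mul,
    ξ.mat_conjTranspose, trace_padInv_mul S hξ]

/-- The inner products of the gradients of the logarithms of two nested principal minors. -/
lemma inner_padInv_conjBy_padInv {S T : Finset ι} (h : S ⊆ T) {ξ : Herm 𝕜 ι} (hξ : ξ ∈ cone 𝕜 ι) :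
    inner ℝ (padInv T ξ) (conjBy ξ.mat (padInv S ξ)) = S.card := by
  rw [Herm.inner_eq, mat_conjBy, ξ.mat_conjTranspose, ← Matrix.mul_assoc, ← Matrix.mul_assoc,
    padInv_mul_mul_padInv h hξ, trace_padInv_mul S hξ]

lemma hasFDerivAt_corner (S : Finset ι) (ξ : Herm 𝕜 ι) : HasFDerivAt (corner S)
    (LinearMap.toContinuousLinearMap (conjBy (proj 𝕜 S).mat)) ξ :=
  (LinearMap.toContinuousLinearMap (conjBy (proj 𝕜 S).mat)).hasFDerivAt.add_const _

lemma hasFDerivAt_log_corner (S : Finset ι) {ξ : Herm 𝕜 ι} (hξ : ξ ∈ cone 𝕜 ι) :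
    HasFDerivAt (fun ξ => Real.log (rdet (corner S ξ).mat)) (innerSL ℝ (padInv S ξ)) ξ := by
  refine ((hasFDerivAt_log_rdet (corner_mem_cone S hξ)).comp ξ
    (hasFDerivAt_corner S ξ)).congr_fderiv ?_
  refine ContinuousLinearMap.ext fun u => ?_
  change inner ℝ (corner S ξ).inv (conjBy (proj 𝕜 S).mat u) = inner ℝ (padInv S ξ) u
  rw [padInv, inner_conjBy_mat]

lemma hasFDerivAt_padInv (S : Finset ι) {ξ : Herm 𝕜 ι} (hξ : ξ ∈ cone 𝕜 ι) :
    HasFDerivAt (padInv S) (-LinearMap.toContinuousLinearMap (conjBy (padInv S ξ).mat)) ξ := by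
  refine ((LinearMap.toContinuousLinearMap (conjBy (proj 𝕜 S).mat)).hasFDerivAt.comp ξ
    ((hasFDerivAt_inv (corner_mem_cone S hξ)).comp ξ (hasFDerivAt_corner S ξ))).congr_fderiv ?_
  refine ContinuousLinearMap.ext fun u => ?_
  change conjBy (proj 𝕜 S).mat (-conjBy (corner S ξ).inv.mat (conjBy (proj 𝕜 S).mat u)) =
    -conjBy (padInv S ξ).mat u
  rw [map_neg, ← LinearMap.comp_apply, ← LinearMap.comp_apply, ← conjBy_mul, ← conjBy_mul, padInv,
    mat_conjBy, (proj 𝕜 S).mat_conjTranspose]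

open scoped Matrix.Norms.Operator in
/-- The derivative of the Riemannian gradient `ξ A ξ` of the logarithm of a principal minor is
`u ↦ u - (1 - ξ A) u (1 - ξ A)*`. -/
lemma hasFDerivAt_conjBy_padInv (S : Finset ι) {ξ : Herm 𝕜 ι} (hξ : ξ ∈ cone 𝕜 ι) :
    HasFDerivAt (fun ξ => conjBy ξ.mat (padInv S ξ)) (LinearMap.toContinuousLinearMap
      (LinearMap.id - conjBy (1 - ξ.mat * (padInv S ξ).mat))) ξ := by
  have hm : HasFDerivAt (fun x : Herm 𝕜 ι => x.mat)
      (LinearMap.toContinuousLinearMap (Herm.matLin 𝕜 ι)) ξ :=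
    (LinearMap.toContinuousLinearMap (Herm.matLin 𝕜 ι)).hasFDerivAt
  have hA : HasFDerivAt (fun x : Herm 𝕜 ι => (padInv S x).mat) _ ξ :=
    (LinearMap.toContinuousLinearMap (Herm.matLin 𝕜 ι)).hasFDerivAt.comp ξ (hasFDerivAt_padInv S hξ)
  have h := (LinearMap.toContinuousLinearMap
    (selfAdjointPartLin (𝕜 := 𝕜) (ι := ι))).hasFDerivAt.comp ξ ((hm.mul' hA).mul' hm)
  refine (h.congr_fderiv ?_).congr_of_eventuallyEq (.of_forall fun y => ?_)
  · refine ContinuousLinearMap.ext fun u => ?_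
    change selfAdjointPartLin ((ξ.mat * (padInv S ξ).mat) * u.mat +
      (ξ.mat * (-conjBy (padInv S ξ).mat u).mat + u.mat * (padInv S ξ).mat) * ξ.mat) =
      u - conjBy (1 - ξ.mat * (padInv S ξ).mat) u
    rw [← selfAdjointPartLin_mat (u - _)]
    congr 1
    simp only [Herm.mat_neg, Herm.mat_sub, mat_conjBy, Matrix.conjTranspose_sub,
      Matrix.conjTranspose_one, Matrix.conjTranspose_mul, ξ.mat_conjTranspose,
      (padInv S ξ).mat_conjTranspose]
    noncomm_ring
  · change conjBy y.mat (padInv S y) = selfAdjointPartLin (y.mat * (padInv S y).mat * y.mat)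
    rw [← selfAdjointPartLin_mat (conjBy _ _), mat_conjBy, y.mat_conjTranspose]

/-- The projection `1 - ξ A` is conjugate to the diagonal projection onto the complement of `S` by a
unipotent matrix. -/
lemma trace_conjBy_one_sub (S : Finset ι) {ξ : Herm 𝕜 ι} (hξ : ξ ∈ cone 𝕜 ι) :
    LinearMap.trace ℝ _ (conjBy (1 - ξ.mat * (padInv S ξ).mat)) =
      LinearMap.trace ℝ _ (conjBy (proj 𝕜 Sᶜ).mat) := by
  set P := (proj 𝕜 S).mat with hPdef
  set E := ξ.mat * (padInv S ξ).mat with hE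
  have hP : P * P = P := proj_mul_proj (subset_refl S)
  have hEE : E * E = E := by
    rw [hE, Matrix.mul_assoc, ← Matrix.mul_assoc (padInv S ξ).mat,
      padInv_mul_mul_padInv (subset_refl S) hξ]
  have hEP : E * P = E := by rw [hE, Matrix.mul_assoc, padInv_mul_proj]
  have hPE : P * E = P := by rw [hE, ← Matrix.mul_assoc, proj_mul_mul_padInv S hξ]
  have h1 : (1 - (E - P)) * (1 + (E - P)) = 1 := by
    simp only [mul_add, sub_mul, mul_sub, mul_one, one_mul, hEE, hEP, hPE, hP]
    abel
  have h2 : 1 - E = (1 + (E - P)) * (1 - P) * (1 - (E - P)) := by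
    simp only [add_mul, sub_mul, mul_sub, mul_one, one_mul, hEE, hEP, hPE, hP]
    abel
  rw [h2, conjBy_mul, LinearMap.trace_comp_comm', ← conjBy_mul, ← Matrix.mul_assoc, h1, one_mul,
    proj_compl]

/-- The Laplacian of the logarithm of the principal minor of size `m` is `(d / 2) m (r - m)`. -/
lemma trace_fderiv_sub_log_corner (S : Finset ι) {ξ : Herm 𝕜 ι} (hξ : ξ ∈ cone 𝕜 ι) :
    LinearMap.trace ℝ _ (LinearMap.id - conjBy (1 - ξ.mat * (padInv S ξ).mat)) -
      dimRatio 𝕜 ι * inner ℝ ξ.inv (conjBy ξ.mat (padInv S ξ)) =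
    peirceInv 𝕜 / 2 * S.card * (Fintype.card ι - S.card) := by
  have h1 : (LinearMap.id : Herm 𝕜 ι →ₗ[ℝ] Herm 𝕜 ι) = conjBy (proj 𝕜 Finset.univ).mat := by
    rw [← conjBy_one, mat_proj]
    simp
  rw [map_sub, trace_conjBy_one_sub S hξ, h1, trace_conjBy_proj, trace_conjBy_proj,
    inner_inv_conjBy_padInv S hξ, Finset.card_univ, Finset.card_compl,
    Nat.cast_sub (Finset.card_le_univ S), dimRatio]
  ring

end

/-! ### Block partitions and the eigenfunctions -/

section

variable {𝕜 : Type*} {ι : Type u} [RCLike 𝕜] [Fintype ι] [DecidableEq ι]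

/-- The determinant of `corner S ξ` is the principal minor, its rows and columns being indexed through
any bijection `e` onto `S`. -/
lemma det_corner {α : Type*} [Fintype α] [DecidableEq α] (S : Finset ι) (e : α ≃ {i // i ∈ S})
    (ξ : Herm 𝕜 ι) :
    (corner S ξ).mat.det = ((ξ.mat.toSquareBlockProp (· ∈ S)).submatrix e e).det := by
  have hentry : ∀ i j, (corner S ξ).mat i j =
      if i ∈ S ∧ j ∈ S then ξ.mat i j else if i ∈ S then 0 else (1 : Matrix ι ι 𝕜) i j := by
    intro i j
    rw [corner, Herm.mat_add, Matrix.add_apply, mat_proj, conjBy_diagonal_apply, mat_proj,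
      Matrix.diagonal_apply, Matrix.one_apply]
    by_cases hi : i ∈ S <;> by_cases hj : j ∈ S <;> by_cases hij : i = j <;>
      simp_all
  rw [Matrix.twoBlockTriangular_det _ (· ∈ S)]
  · have h1 : (corner S ξ).mat.toSquareBlockProp (· ∈ S) = ξ.mat.toSquareBlockProp (· ∈ S) := by
      ext i j
      simp [Matrix.toSquareBlockProp_def, hentry]
    have h2 : (corner S ξ).mat.toSquareBlockProp (fun i => i ∉ S) = 1 := by
      ext i j
      simp [Matrix.toSquareBlockProp_def, hentry, i.2, Matrix.one_apply, Subtype.ext_iff]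
    rw [h1, h2, Matrix.det_one, mul_one]
    convert (Matrix.det_submatrix_equiv_self e (ξ.mat.toSquareBlockProp (· ∈ S))).symm
  · intro i hi j hj
    rw [hentry, if_neg (fun h => hi h.1), if_neg hi, Matrix.one_apply_ne]
    rintro rfl
    exact hi hj

lemma rdet_corner_univ (ξ : Herm 𝕜 ι) : rdet (corner Finset.univ ξ).mat = rdet ξ.mat := by
  rw [mat_corner]
  have : (proj 𝕜 (Finset.univ : Finset ι)).mat = 1 := by simp [mat_proj]
  rw [this]
  simp

lemma rdet_corner_empty (ξ : Herm 𝕜 ι) : rdet (corner ∅ ξ).mat = 1 := by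
  rw [mat_corner]
  have : (proj 𝕜 (∅ : Finset ι)).mat = 0 := by simp [mat_proj]
  rw [this]
  simp [rdet]

lemma contDiff_rdet_corner (S : Finset ι) :
    ContDiff ℝ ∞ fun ξ : Herm 𝕜 ι => rdet (corner S ξ).mat :=
  contDiff_rdet.comp
    ((LinearMap.toContinuousLinearMap (conjBy (proj 𝕜 S).mat)).contDiff.add contDiff_const)

end

section Blocks

variable {𝕜 : Type*} [RCLike 𝕜] {h : ℕ} {k : Fin h → ℕ}

/-- The indices in the blocks with number at least `j`. -/
def tail (k : Fin h → ℕ) (j : ℕ) : Finset (Idx k) :=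
  (Finset.univ.filter fun i : Fin h => j ≤ i).sigma fun _ => Finset.univ

lemma mem_tail {j : ℕ} {p : Idx k} : p ∈ tail k j ↔ j ≤ p.1 := by simp [tail]

lemma tail_subset_tail {i j : ℕ} (hij : i ≤ j) : tail k j ⊆ tail k i := fun _ hp =>
  mem_tail.2 (hij.trans (mem_tail.1 hp))

lemma tail_zero : tail k 0 = Finset.univ := by ext p; simp [mem_tail]

lemma tail_self : tail k h = ∅ := by
  ext p
  simp [mem_tail]

lemma card_tail (j : ℕ) :
    (tail k j).card = ∑ i ∈ Finset.univ.filter fun i : Fin h => j ≤ i, k i := by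
  simp [tail, Finset.card_sigma]

lemma card_tail_succ (i : Fin h) : ((tail k (i + 1)).card : ℝ) = rank k - partialRank k i := by
  rw [card_tail, Nat.cast_sum, rank, partialRank, eq_sub_iff_add_eq, add_comm,
    ← Finset.sum_filter_add_sum_filter_not Finset.univ (· ≤ i)]
  congr 1
  · exact Finset.sum_congr (by ext j; simp) fun _ _ => rfl
  · exact Finset.sum_congr (by ext j; simp) fun _ _ => rfl

lemma card_tail_castSucc (i : Fin h) : ((tail k i).card : ℝ) = (tail k (i + 1)).card + k i := by
  rw [card_tail, card_tail]
  have : (Finset.univ.filter fun j : Fin h => (i : ℕ) ≤ j) =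
      insert i (Finset.univ.filter fun j : Fin h => (i : ℕ) + 1 ≤ j) := by
    ext j
    simp only [Finset.mem_filter, Finset.mem_univ, true_and, Finset.mem_insert, Fin.ext_iff]
    omega
  rw [this, Finset.sum_insert (by simp)]
  push_cast
  ring

lemma card_Idx : (Fintype.card (Idx k) : ℝ) = rank k := by
  simp [rank]

variable (𝕜 k) in
lemma dimRatio_Idx : dimRatio 𝕜 (Idx k) = (rank k - 1) / 2 * peirceInv 𝕜 + 1 := by
  rw [dimRatio, card_Idx]

/-- The indices in the blocks from `i` on are those of block `i` and those of the later blocks. -/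
def tailEquiv (i : Fin h) : Fin (k i) ⊕ {p : Idx k // i < p.1} ≃ {p : Idx k // p ∈ tail k i} :=
  Equiv.ofBijective
    (Sum.elim (fun a => ⟨⟨i, a⟩, mem_tail.2 le_rfl⟩) fun p => ⟨p.1, mem_tail.2 p.2.le⟩) (by
    constructor
    · rintro (a | ⟨p, hp⟩) (b | ⟨q, hq⟩) hab
      · simpa using hab
      · obtain rfl : _ = q := congrArg Subtype.val hab
        exact (lt_irrefl _ hq).elim
      · obtain rfl : p = _ := congrArg Subtype.val hab
        exact (lt_irrefl _ hp).elim
      · obtain rfl : p = q := congrArg Subtype.val hab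
        rfl
    · rintro ⟨⟨j, a⟩, hp⟩
      have hij : i ≤ j := mem_tail.1 hp
      rcases hij.eq_or_lt with rfl | hlt
      · exact ⟨.inl a, rfl⟩
      · exact ⟨.inr ⟨⟨j, a⟩, hlt⟩, rfl⟩)

/-- The Schur complement formula for the minor of a tail of blocks. -/
lemma rdet_corner_tail (i : Fin h) {ξ : Herm 𝕜 (Idx k)} (hξ : ξ ∈ cone 𝕜 (Idx k)) :
    rdet (corner (tail k i) ξ).mat =
      rdet (xiZero ξ.mat i) * rdet (corner (tail k (i + 1)) ξ).mat := by
  set D := ξ.mat.toBlock (fun p : Idx k => i < p.1) (fun p => i < p.1) with hD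
  have hDpos : D.PosDef := Matrix.PosDef.submatrix hξ Subtype.val_injective
  have hDdet : (corner (tail k (i + 1)) ξ).mat.det = D.det := by
    rw [det_corner _ (Equiv.subtypeEquivRight (p := fun p : Idx k => i < p.1)
      (q := fun p => p ∈ tail k (i + 1)) fun p => by rw [mem_tail]; exact Iff.rfl)]
    rfl
  set A : Matrix (Fin (k i)) (Fin (k i)) 𝕜 := fun a b => ξ.mat ⟨i, a⟩ ⟨i, b⟩
  set B : Matrix (Fin (k i)) {p : Idx k // i < p.1} 𝕜 := fun a p => ξ.mat ⟨i, a⟩ p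
  set C : Matrix {p : Idx k // i < p.1} (Fin (k i)) 𝕜 := fun p a => ξ.mat p ⟨i, a⟩
  have hblocks : (ξ.mat.toSquareBlockProp (· ∈ tail k i)).submatrix (tailEquiv i) (tailEquiv i) =
      Matrix.fromBlocks A B C D := by
    ext (a | p) (b | q) <;> rfl
  have hx : xiZero ξ.mat i = A - B * D⁻¹ * C := rfl
  let _ : Invertible D := hDpos.isUnit.invertible
  have hdet : (corner (tail k i) ξ).mat.det = D.det * (xiZero ξ.mat i).det := by
    rw [det_corner _ (tailEquiv i), hblocks,
      Matrix.det_fromBlocks₂₂, hx, Matrix.invOf_eq_nonsing_inv]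
  rw [rdet, hdet, ← ofReal_rdet hDpos.1, RCLike.re_ofReal_mul, mul_comm, rdet, rdet, rdet, hDdet]

lemma rdet_xiZero_eq (i : Fin h) {ξ : Herm 𝕜 (Idx k)} (hξ : ξ ∈ cone 𝕜 (Idx k)) :
    rdet (xiZero ξ.mat i) =
      rdet (corner (tail k i) ξ).mat / rdet (corner (tail k (i + 1)) ξ).mat := by
  rw [rdet_corner_tail i hξ, mul_div_cancel_right₀ _ (rdet_pos (corner_mem_cone _ hξ)).ne']

lemma rdet_xiZero_pos (i : Fin h) {ξ : Herm 𝕜 (Idx k)} (hξ : ξ ∈ cone 𝕜 (Idx k)) :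
    0 < rdet (xiZero ξ.mat i) := by
  rw [rdet_xiZero_eq i hξ]
  exact div_pos (rdet_pos (corner_mem_cone _ hξ)) (rdet_pos (corner_mem_cone _ hξ))

lemma prod_rdet_xiZero {ξ : Herm 𝕜 (Idx k)} (hξ : ξ ∈ cone 𝕜 (Idx k)) :
    ∏ i, rdet (xiZero ξ.mat i) = rdet ξ.mat := by
  have htel : ∀ n, ∏ j ∈ Finset.range n, rdet (corner (tail k j) ξ).mat /
      rdet (corner (tail k (j + 1)) ξ).mat =
      rdet (corner (tail k 0) ξ).mat / rdet (corner (tail k n) ξ).mat := by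
    have hN := fun j => (rdet_pos (corner_mem_cone (tail k j) hξ)).ne'
    intro n
    induction n with
    | zero => rw [Finset.prod_range_zero, div_self (hN 0)]
    | succ n ih => rw [Finset.prod_range_succ, ih, div_mul_div_cancel₀ (hN n)]
  simp only [rdet_xiZero_eq _ hξ]
  rw [Fin.prod_univ_eq_prod_range (fun j => rdet (corner (tail k j) ξ).mat /
    rdet (corner (tail k (j + 1)) ξ).mat), htel, tail_zero, tail_self, rdet_corner_univ,
    rdet_corner_empty, div_one]

/-- The Fisher metric is the invariant metric of the cone. For `h = 0` there are no nonzero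
directions, and `μ` may vanish. -/
lemma isConeMetric_unitFisher (hk : ∀ i, 0 < k i) {μ : ℝ}
    (hμ : (rank k - 1) / 2 * peirceInv 𝕜 < μ) :
    IsConeMetric (unitFisher μ : Herm 𝕜 (Idx k) → _ → _ → ℝ) := by
  intro ξ hξ u v
  rcases Nat.eq_zero_or_pos h with rfl | hh
  · have hv : v = 0 := Herm.ext_mat (by ext ⟨i, _⟩; exact i.elim0)
    simp [hv, unitFisher, fisher]
  · refine unitFisher_eq (by rw [dimRatio_Idx]; linarith) (ne_of_gt ?_) hξ u v
    have h1 : (1 : ℝ) ≤ rank k := by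
      have h2 := Finset.single_le_sum (f := k) (fun i _ => Nat.zero_le _)
        (Finset.mem_univ ⟨0, hh⟩)
      have h3 : 1 ≤ ∑ i, k i := (hk ⟨0, hh⟩).trans_le h2
      rw [rank]
      exact_mod_cast h3
    have h4 : (0 : ℝ) ≤ peirceInv 𝕜 := Nat.cast_nonneg _
    have : 0 ≤ (rank k - 1) / 2 * peirceInv 𝕜 := by
      have : 0 ≤ rank k - 1 := by linarith
      positivity
    linarith

lemma jeffreys_eq {μ : ℝ} (hg : IsConeMetric (unitFisher μ : Herm 𝕜 (Idx k) → _ → _ → ℝ))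
    {ξ : Herm 𝕜 (Idx k)} (hξ : ξ ∈ cone 𝕜 (Idx k)) :
    jeffreys μ ξ = rdet ξ.mat ^ (-dimRatio 𝕜 (Idx k)) := by
  rw [jeffreys, hg.sqrt_det_gram _ hξ]
  have : (Matrix.of fun i j => inner ℝ
      ((stdOrthonormalBasis ℝ (Herm 𝕜 (Idx k))).toBasis i)
      ((stdOrthonormalBasis ℝ (Herm 𝕜 (Idx k))).toBasis j)) = 1 := by
    ext i j
    simp [Matrix.one_apply,
      orthonormal_iff_ite.1 (stdOrthonormalBasis ℝ (Herm 𝕜 (Idx k))).orthonormal]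
  rw [this]
  simp

lemma K_eq_prod {μ : ℝ} (hg : IsConeMetric (unitFisher μ : Herm 𝕜 (Idx k) → _ → _ → ℝ))
    (t : Fin h → ℝ) {ξ : Herm 𝕜 (Idx k)} (hξ : ξ ∈ cone 𝕜 (Idx k)) :
    K μ t ξ = ∏ i, rdet (xiZero ξ.mat i) ^
      (1 / 2 * (t i + (rank k - 1) / 2 * peirceInv 𝕜 + 1)) := by
  have hp := fun i => rdet_xiZero_pos i hξ
  rw [K, jeffreys_eq hg hξ, prior, ← prod_rdet_xiZero hξ,
    ← Real.finsetProd_rpow _ _ fun i _ => (hp i).le, ← Finset.prod_div_distrib,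
    ← Real.finsetProd_rpow]
  · refine Finset.prod_congr rfl fun i _ => ?_
    rw [← Real.rpow_sub (hp i), ← Real.rpow_mul (hp i).le, dimRatio_Idx]
    ring_nf
  · exact fun i _ => div_nonneg (Real.rpow_nonneg (hp i).le _) (Real.rpow_nonneg (hp i).le _)

/-- The exponent of `|ξ₀⁽ⁱ⁾|` in `K_t`. -/
def kExponent (d : ℝ) (k : Fin h → ℕ) (t : Fin h → ℝ) (i : Fin h) : ℝ :=
  1 / 2 * (t i + (rank k - 1) / 2 * d + 1)

/-- The logarithm of `∏ᵢ |ξ₀⁽ⁱ⁾| ^ sᵢ`, in terms of principal minors. -/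
def logPower (s : Fin h → ℝ) (ξ : Herm 𝕜 (Idx k)) : ℝ :=
  ∑ i, s i * (Real.log (rdet (corner (tail k i) ξ).mat) -
    Real.log (rdet (corner (tail k (i + 1)) ξ).mat))

/-- The Euclidean gradient of `log |ξ₀⁽ⁱ⁾|`. -/
def blockGrad (i : Fin h) (ξ : Herm 𝕜 (Idx k)) : Herm 𝕜 (Idx k) :=
  padInv (tail k i) ξ - padInv (tail k (i + 1)) ξ

lemma prod_rpow_eq_exp_logPower (s : Fin h → ℝ) {ξ : Herm 𝕜 (Idx k)} (hξ : ξ ∈ cone 𝕜 (Idx k)) :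
    ∏ i, rdet (xiZero ξ.mat i) ^ s i = Real.exp (logPower s ξ) := by
  rw [logPower, Real.exp_sum]
  refine Finset.prod_congr rfl fun i _ => ?_
  rw [Real.rpow_def_of_pos (rdet_xiZero_pos i hξ), rdet_xiZero_eq i hξ,
    Real.log_div (rdet_pos (corner_mem_cone _ hξ)).ne' (rdet_pos (corner_mem_cone _ hξ)).ne',
    mul_comm]

lemma contDiffOn_logPower (s : Fin h → ℝ) :
    ContDiffOn ℝ ∞ (logPower s : Herm 𝕜 (Idx k) → ℝ) (cone 𝕜 (Idx k)) := by
  have hlog : ∀ j, ContDiffOn ℝ ∞ (fun ξ : Herm 𝕜 (Idx k) =>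
      Real.log (rdet (corner (tail k j) ξ).mat)) (cone 𝕜 (Idx k)) := fun j =>
    (contDiff_rdet_corner _).contDiffOn.log fun ξ hξ => (rdet_pos (corner_mem_cone _ hξ)).ne'
  exact ContDiffOn.sum fun i _ => contDiffOn_const.mul ((hlog i).sub (hlog (i + 1)))

lemma hasFDerivAt_logPower (s : Fin h → ℝ) {ξ : Herm 𝕜 (Idx k)} (hξ : ξ ∈ cone 𝕜 (Idx k)) :
    HasFDerivAt (logPower s) (innerSL ℝ (∑ i, s i • blockGrad i ξ)) ξ := by
  have h1 := HasFDerivAt.fun_sum (u := Finset.univ) fun (i : Fin h) _ =>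
    ((hasFDerivAt_log_corner (tail k i) hξ).sub
      (hasFDerivAt_log_corner (tail k (i + 1)) hξ)).const_mul (s i)
  refine h1.congr_fderiv ?_
  simp only [map_sum, map_smul, map_sub, blockGrad]

/-- The gradients of the functions `log |ξ₀⁽ⁱ⁾|` are orthogonal for the Fisher metric, with squared
length `k⁽ⁱ⁾`. -/
lemma inner_blockGrad (i j : Fin h) {ξ : Herm 𝕜 (Idx k)} (hξ : ξ ∈ cone 𝕜 (Idx k)) :
    inner ℝ (blockGrad i ξ) (conjBy ξ.mat (blockGrad j ξ)) = if i = j then (k i : ℝ) else 0 := by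
  have hlt : ∀ i j : Fin h, i < j →
      inner ℝ (blockGrad i ξ) (conjBy ξ.mat (blockGrad j ξ)) = 0 := by
    intro i j hij
    have hij' : (i : ℕ) + 1 ≤ j := hij
    simp only [blockGrad, map_sub, inner_sub_left, inner_sub_right]
    rw [inner_padInv_conjBy_padInv (tail_subset_tail (by omega)) hξ,
      inner_padInv_conjBy_padInv (tail_subset_tail (by omega)) hξ,
      inner_padInv_conjBy_padInv (tail_subset_tail (by omega)) hξ,
      inner_padInv_conjBy_padInv (tail_subset_tail (by omega)) hξ]
    ring
  rcases lt_trichotomy i j with hij | rfl | hij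
  · rw [hlt i j hij, if_neg hij.ne]
  · rw [if_pos rfl]
    have h1 := inner_padInv_conjBy_padInv (tail_subset_tail (k := k) (Nat.le_succ i)) hξ
    have h2 := h1
    rw [← inner_conjBy_mat, real_inner_comm] at h2
    simp only [blockGrad, map_sub, inner_sub_left, inner_sub_right]
    rw [inner_padInv_conjBy_padInv (subset_refl (tail k i)) hξ,
      inner_padInv_conjBy_padInv (subset_refl (tail k (i + 1))) hξ, h1, h2,
      card_tail_castSucc]
    ring
  · rw [← inner_conjBy_mat, real_inner_comm, hlt j i hij, if_neg hij.ne']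

/-- The eigenvalue, expressed by the exponents of the functions `|ξ₀⁽ⁱ⁾|`. -/
lemma eigenvalue_eq (d : ℝ) (t : Fin h → ℝ) : eigenvalue d k t =
    ∑ i, (kExponent d k t i * (d / 2 * k i * (2 * partialRank k i - rank k - k i)) +
      kExponent d k t i ^ 2 * k i) := by
  refine Finset.sum_congr rfl fun i _ => ?_
  rw [tR, kExponent]
  ring

/-- The derivative of the Riemannian gradient of `log |ξ₀⁽ⁱ⁾|`. -/
def blockHess (i : Fin h) (ξ : Herm 𝕜 (Idx k)) : Herm 𝕜 (Idx k) →ₗ[ℝ] Herm 𝕜 (Idx k) :=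
  (LinearMap.id - conjBy (1 - ξ.mat * (padInv (tail k i) ξ).mat)) -
    (LinearMap.id - conjBy (1 - ξ.mat * (padInv (tail k (i + 1)) ξ).mat))

lemma hasFDerivAt_conjBy_blockGrad (i : Fin h) {ξ : Herm 𝕜 (Idx k)} (hξ : ξ ∈ cone 𝕜 (Idx k)) :
    HasFDerivAt (fun ξ => conjBy ξ.mat (blockGrad i ξ))
      (LinearMap.toContinuousLinearMap (blockHess i ξ)) ξ := by
  refine (((hasFDerivAt_conjBy_padInv (tail k i) hξ).sub (hasFDerivAt_conjBy_padInv (tail k (i + 1))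
    hξ)).congr_fderiv ?_).congr_of_eventuallyEq (.of_forall fun y => map_sub _ _ _)
  rw [blockHess, ← map_sub]

/-- The Laplacian of `log |ξ₀⁽ⁱ⁾|` is constant, being the difference of those of two principal
minors. -/
lemma trace_blockHess (i : Fin h) {ξ : Herm 𝕜 (Idx k)} (hξ : ξ ∈ cone 𝕜 (Idx k)) :
    LinearMap.trace ℝ _ (blockHess i ξ) -
      dimRatio 𝕜 (Idx k) * inner ℝ ξ.inv (conjBy ξ.mat (blockGrad i ξ)) =
    peirceInv 𝕜 / 2 * k i * (2 * partialRank k i - rank k - k i) := by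
  have h1 := trace_fderiv_sub_log_corner (tail k i) hξ
  have h2 := trace_fderiv_sub_log_corner (tail k (i + 1)) hξ
  rw [card_tail_castSucc, card_tail_succ, card_Idx] at h1
  rw [card_tail_succ, card_Idx] at h2
  rw [blockHess, blockGrad, map_sub (LinearMap.trace ℝ _), map_sub (conjBy ξ.mat), inner_sub_right]
  linear_combination h1 - h2

lemma laplaceBeltrami_K {μ : ℝ} (hg : IsConeMetric (unitFisher μ : Herm 𝕜 (Idx k) → _ → _ → ℝ))
    (t : Fin h → ℝ) {β : Type*} [Fintype β] [DecidableEq β]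
    (b : Module.Basis β ℝ (Herm 𝕜 (Idx k))) {ξ : Herm 𝕜 (Idx k)} (hξ : ξ ∈ cone 𝕜 (Idx k)) :
    laplaceBeltrami (unitFisher μ) b (K μ t) ξ = eigenvalue (peirceInv 𝕜) k t * K μ t ξ := by
  set s := kExponent (peirceInv 𝕜) k t with hs
  have hK : ∀ y ∈ cone 𝕜 (Idx k), K μ t y = Real.exp (logPower s y) := fun y hy => by
    rw [K_eq_prod hg t hy, ← prod_rpow_eq_exp_logPower s hy]
    rfl
  have hW : HasFDerivAt (fun y : Herm 𝕜 (Idx k) => conjBy y.mat (∑ i, s i • blockGrad i y))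
      (LinearMap.toContinuousLinearMap (∑ i, s i • blockHess i ξ)) ξ := by
    have h1 := HasFDerivAt.fun_sum (u := Finset.univ) fun (i : Fin h) _ =>
      (hasFDerivAt_conjBy_blockGrad i hξ).const_smul (s i)
    refine (h1.congr_fderiv ?_).congr_of_eventuallyEq (.of_forall fun y => ?_)
    · simp only [map_sum, map_smul]
    · simp only [map_sum, map_smul, Pi.smul_apply]
  rw [hg.laplaceBeltrami_exp b hK (fun y hy => hasFDerivAt_logPower s hy) hξ hW, eigenvalue_eq]
  congr 1
  have hq : inner ℝ (∑ i, s i • blockGrad i ξ) (conjBy ξ.mat (∑ i, s i • blockGrad i ξ)) =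
      ∑ i, s i ^ 2 * k i := by
    simp only [map_sum, map_smul, sum_inner, inner_sum, real_inner_smul_left,
      real_inner_smul_right, inner_blockGrad _ _ hξ]
    refine Finset.sum_congr rfl fun i _ => ?_
    simp
    ring
  have hl : LinearMap.trace ℝ _ (∑ i, s i • blockHess i ξ) - dimRatio 𝕜 (Idx k) *
      inner ℝ ξ.inv (conjBy ξ.mat (∑ i, s i • blockGrad i ξ)) =
      ∑ i, s i * (peirceInv 𝕜 / 2 * k i * (2 * partialRank k i - rank k - k i)) := by
    simp only [map_sum, map_smul, inner_sum, real_inner_smul_right, smul_eq_mul, Finset.mul_sum,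
      ← Finset.sum_sub_distrib]
    refine Finset.sum_congr rfl fun i _ => ?_
    rw [← trace_blockHess i hξ]
    ring
  rw [LinearMap.coe_toContinuousLinearMap, hq, Finset.sum_add_distrib, ← hl]
  ring

lemma eigenvalue_tR_le (d : ℝ) (k : Fin h → ℕ) (t : Fin h → ℝ) :
    eigenvalue d k (tR d k) ≤ eigenvalue d k t := by
  refine Finset.sum_le_sum fun i _ => ?_
  have : 0 ≤ 1 / 4 * (k i : ℝ) * (t i - tR d k i) ^ 2 := by positivity
  simp only [sub_self]
  linarith

end Blocks

end Wishart

end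

theorem proposition1 {𝕜 : Type*} [RCLike 𝕜] {h : ℕ} (k : Fin h → ℕ) (hk : ∀ i, 0 < k i)
    (μ : ℝ) (hμ : (Wishart.rank k - 1) / 2 * Wishart.peirceInv 𝕜 < μ) :
    -- the Fisher metric is positive definite
    (∀ {β : Type} [Fintype β] (b : Module.Basis β ℝ (Wishart.Herm 𝕜 (Wishart.Idx k))),
      ∀ ξ ∈ Wishart.cone 𝕜 (Wishart.Idx k),
        (Wishart.gram (Wishart.unitFisher μ) b ξ).PosDef) ∧
    (∀ t : Fin h → ℝ,
      -- the formula for `K_t`, its positivity and its smoothness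
      (∀ ξ ∈ Wishart.cone 𝕜 (Wishart.Idx k),
        Wishart.K μ t ξ =
          ∏ i, Wishart.rdet (Wishart.xiZero ξ.mat i) ^
            (1 / 2 * (t i + (Wishart.rank k - 1) / 2 * Wishart.peirceInv 𝕜 + 1)) ∧
        0 < Wishart.K μ t ξ) ∧
      ContDiffOn ℝ ∞ (Wishart.K μ t) (Wishart.cone 𝕜 (Wishart.Idx k)) ∧
      -- the eigenvalue equation, in any linear coordinates
      (∀ {β : Type} [Fintype β] [DecidableEq β]
        (b : Module.Basis β ℝ (Wishart.Herm 𝕜 (Wishart.Idx k))),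
        ∀ ξ ∈ Wishart.cone 𝕜 (Wishart.Idx k),
          Wishart.laplaceBeltrami (Wishart.unitFisher μ) b (Wishart.K μ t) ξ =
            Wishart.eigenvalue (Wishart.peirceInv 𝕜) k t * Wishart.K μ t ξ)) ∧
    -- the eigenvalue is minimal at `t = t_R`
    (∀ t : Fin h → ℝ,
      Wishart.eigenvalue (Wishart.peirceInv 𝕜) k (Wishart.tR (Wishart.peirceInv 𝕜) k) ≤
        Wishart.eigenvalue (Wishart.peirceInv 𝕜) k t) := by

  have hg := Wishart.isConeMetric_unitFisher (𝕜 := 𝕜) hk hμ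
  refine ⟨fun b ξ hξ => hg.posDef_gram b hξ, fun t => ⟨fun ξ hξ => ?_, ?_, fun b ξ hξ => ?_⟩,
    Wishart.eigenvalue_tR_le _ k⟩
  · have hK := Wishart.K_eq_prod hg t hξ
    refine ⟨hK, ?_⟩
    rw [hK]
    exact Finset.prod_pos fun i _ => Real.rpow_pos_of_pos (Wishart.rdet_xiZero_pos i hξ) _
  · refine (Wishart.contDiffOn_logPower (Wishart.kExponent (Wishart.peirceInv 𝕜) k t)).exp.congr
      fun ξ hξ => ?_
    rw [Wishart.K_eq_prod hg t hξ, ← Wishart.prod_rpow_eq_exp_logPower _ hξ]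
    rfl
  · exact Wishart.laplaceBeltrami_K hg t b hξ
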